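/- Let $\mathcal C$ be a small category; write composition from left to right. Assume that $\mathcal C$ satisfies the cancellative calculus of fractions, that is: - (square filling) for all arrows $f\colon B\to A$ and $g\colon C\to A$ there are arrows $a\colon D\to B$ and $b\colon D\to C$ with $af=bg$; - (equalization) whenever $f,g\colon A\to B$ and $a\colon B\to C$ satisfy $fa=ga$, there is an arrow $b\colon D\to A$ with $bf=bg$; - (cancellation) for all arrows, $fa=ga$ implies $f=g$, and $af=ag$ implies $f=g$. Let $\pi_1(\mathcal C)$ be the fundamental groupoid of $\mathcal C$: its objects are those of $\mathcal C$ and its arrows are zig-zags of arrows of $\mathcal C$ modulo homotopy; equivalently, it is the free groupoid on the category $\mathcal C$. Let $\varphi\colon\mathcal C\to\pi_1(\mathcal C)$ be the canonical functor. Write $B(-)$ for the classifying space of a category, i.e. the geometric realization of its nerve. Then $\varphi$ is faithful, and the induced map $B\varphi\colon B(\mathcal C)\to B(\pi_1(\mathcal C))$ is a homotopy equivalence. In particular, for every object $X$ of $\mathcal C$, consider the universal covering category $\mathcal U_X(\mathcal C)=X{\downarrow}\varphi$, whose objects are pairs $(Z,a)$ of an object $Z$ of $\mathcal C$ and an arrow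 $a\colon \varphi(X)\to\varphi(Z)$ in $\pi_1(\mathcal C)$, and whose arrows $(Z,a)\to(Z',a')$ are the arrows $\gamma\colon Z\to Z'$ of $\mathcal C$ with $a\,\varphi(\gamma)=a'$. Then $\mathcal U_X(\mathcal C)$ is a generalized poset (any two parallel arrows are equal) and is contractible (its classifying space is contractible). -/

import Mathlib

open CategoryTheory

universe v u

noncomputable section

/-- A category satisfies the *cancellative calculus of fractions* if it satisfies the (right)
calculus of fractions with respect to all its arrows and is left and right cancellative.
Compositions are written in diagrammatic order.

The field `fractions` says: every cospan `f : B ⟶ A`, `g : C ⟶ A` can be completed to a square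
`a ≫ f = b ≫ g`, and whenever `f ≫ a = g ≫ a` there is an arrow `b` with `b ≫ f = b ≫ g`. -/
structure SatisfiesCancellativeCalculusOfFractions (C : Type u) [Category.{v} C] : Prop where
  fractions : (⊤ : MorphismProperty C).HasRightCalculusOfFractions
  right_cancel : ∀ {A B D : C} (f g : A ⟶ B) (a : B ⟶ D), f ≫ a = g ≫ a → f = g
  left_cancel : ∀ {A B D : C} (a : A ⟶ B) (f g : B ⟶ D), a ≫ f = a ≫ g → f = g

/-- The fundamental groupoid `π₁(C)`: its objects are the objects of `C`, its arrows are zig-zags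
of arrows of `C` modulo homotopy. This is the free groupoid on the category `C`. -/
abbrev FundamentalGroupoidOfCategory (C : Type u) [Category.{v} C] : Type u :=
  CategoryTheory.FreeGroupoid C

/-- The canonical functor `φ : C ⥤ π₁(C)`, the identity on objects. -/
abbrev toFundamentalGroupoid (C : Type u) [Category.{v} C] :
    C ⥤ FundamentalGroupoidOfCategory C :=
  CategoryTheory.FreeGroupoid.of C

/-- The universal covering category `U_X(C) = X ↓ φ`: objects are pairs `(B, γ)` of an object `B`
of `C` and an arrow `γ : φ(X) ⟶ φ(B)` of `π₁(C)`, arrows `(B, γ) ⟶ (B', γ')` are arrows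
`b : B ⟶ B'` of `C` with `γ ≫ φ(b) = γ'`. -/
abbrev UniversalCoveringCategory (C : Type u) [Category.{v} C] (X : C) : Type (max u v) :=
  StructuredArrow ((toFundamentalGroupoid C).obj X) (toFundamentalGroupoid C)

/-- The classifying space `B(C)`: the geometric realization of the nerve of `C`. -/
abbrev ClassifyingSpace (C : Type u) [Category.{v} C] : TopCat.{max u v} :=
  SSet.toTop.obj (nerve C)

/-- A category is contractible if its classifying space is. -/
def IsContractibleCategory (C : Type u) [Category.{v} C] : Prop :=
  ContractibleSpace (ClassifyingSpace C)

/-- The map `N(F) : N(C) ⟶ N(D)` of nerves induced by a functor `F : C ⥤ D`, sending a chain of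
composable arrows to its image under `F`. This is `CategoryTheory.nerveMap`, except that the arrows
of `D` may live in a larger universe, so that `D` may be the fundamental groupoid of `C`. -/
def nerveMapOfFunctor {C D : Type u} [Category.{v} C] [Category.{max u v} D] (F : C ⥤ D) :
    (nerve C : SSet.{max u v}) ⟶ (nerve D : SSet.{max u v}) where
  app _ := ↾fun X ↦ (F.mapComposableArrows _).obj X

/-- The continuous map `BF : B(C) → B(D)` induced by a functor `F : C ⥤ D`. -/
def classifyingMap {C D : Type u} [Category.{v} C] [Category.{max u v} D] (F : C ⥤ D) :
    C(ClassifyingSpace C, ClassifyingSpace D) :=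
  (SSet.toTop.map (nerveMapOfFunctor F)).hom

/-- A functor `F` is a homotopy equivalence if `BF` is a homotopy equivalence of spaces. -/
def IsHomotopyEquivalenceFunctor {C D : Type u} [Category.{v} C] [Category.{max u v} D]
    (F : C ⥤ D) : Prop :=
  ∃ e : ContinuousMap.HomotopyEquiv (ClassifyingSpace C) (ClassifyingSpace D),
    e.toFun = classifyingMap F

/-- A generalized poset: any two parallel arrows are equal. -/
def IsGeneralizedPoset (C : Type u) [Category.{v} C] : Prop :=
  ∀ (A B : C) (α β : A ⟶ B), α = β

end

/-! The functor `φ` is the localization of `C` at all its arrows. By calculus of right fractions,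
two arrows identified by `φ` are equalized by precomposition with some arrow, so left cancellation
makes `φ` faithful. Hence `X ↓ φ` is thin. Writing an arrow of `π₁(C)` as a right fraction shows
that any two objects of `X ↓ φ` have a common lower bound.

A nonempty thin category with common lower bounds is contractible: its nerve is a directed union of
subcomplexes, each a cone with apex `z` (`contractibleSpace_nerveAbove`,
`contractibleSpace_of_directed`).

That `Bφ` is an equivalence is then Quillen's Theorem A for a map to the nerve of a groupoid `D`
(`exists_homotopyEquiv_of_contractible_cover`). The fibres of `s : S ⟶ nerve D` form a local system
on `D`; when their realizations are contractible, the total object of their singular sets is a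
trivial fibration over `nerve D`. A section of it gives the homotopy inverse, and lifts of one map
to the base become homotopic in the realization.

All the homotopy theory rests on one fact: for contractible `Y`, the singular sets of `Y` and of its
path space have the right lifting property against `∂Δ[n] ⟶ Δ[n]`, over the point and over `Y × Y`
respectively. Lifting into path spaces replaces explicit coherent choices of homotopies. -/

noncomputable section

/-! ### Extending maps into contractible spaces from the boundary of a convex body -/

section Topology

open Set Topology

/-- Let `X` be the intersection of a set `S` with finitely many half-spaces `0 ≤ ℓ i`, where the
`ℓ i` are affine functions with value `1` at a centre `c`. Then any continuous map from the
boundary of `X` to a contractible space extends to `X`. -/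
theorem exists_extension_of_contractible {V Y ι : Type*} [TopologicalSpace V] [AddCommGroup V]
    [Module ℝ V] [ContinuousAdd V] [ContinuousSMul ℝ V] [TopologicalSpace Y] [ContractibleSpace Y]
    [Fintype ι] [Nonempty ι] (S : Set V) (c : V) (ℓ : ι → V → ℝ) (hℓ : ∀ i, Continuous (ℓ i))
    (hℓc : ∀ i (a b : ℝ) x, a + b = 1 → ℓ i (a • x + b • c) = a * ℓ i x + b)
    (hS : ∀ (a b : ℝ) x, x ∈ S → a + b = 1 → a • x + b • c ∈ S)
    (f : V → Y) (hf : ContinuousOn f {x | (x ∈ S ∧ ∀ i, 0 ≤ ℓ i x) ∧ ∃ i, ℓ i x = 0}) :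
    ∃ F : V → Y, ContinuousOn F {x | x ∈ S ∧ ∀ i, 0 ≤ ℓ i x} ∧
      ∀ x, (x ∈ S ∧ ∀ i, 0 ≤ ℓ i x) → (∃ i, ℓ i x = 0) → F x = f x := by
  obtain ⟨y₀, ⟨H⟩⟩ := id_nullhomotopic Y
  let m : V → ℝ := fun x ↦ Finset.univ.inf' Finset.univ_nonempty fun i ↦ ℓ i x
  have hm : Continuous m := Continuous.finset_inf'_apply _ fun i _ ↦ hℓ i
  have hmle : ∀ x i, m x ≤ ℓ i x := fun x i ↦ Finset.inf'_le _ (Finset.mem_univ i)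
  have hmex : ∀ x, ∃ i, ℓ i x = m x := fun x ↦ by
    obtain ⟨i, -, hi⟩ := Finset.exists_mem_eq_inf' Finset.univ_nonempty fun i ↦ ℓ i x
    exact ⟨i, hi.symm⟩
  -- Radial projection from `c`: where `m < 1` it moves `x` away from `c` until the smallest `ℓ i`
  -- vanishes.
  let r : V → V := fun x ↦ (1 - m x)⁻¹ • x + (1 - (1 - m x)⁻¹) • c
  have hr : ∀ x, (x ∈ S ∧ ∀ i, 0 ≤ ℓ i x) → m x < 1 →
      (r x ∈ S ∧ ∀ i, 0 ≤ ℓ i (r x)) ∧ ∃ i, ℓ i (r x) = 0 := by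
    intro x hx h1
    have h1' : 0 < 1 - m x := by linarith
    have key : ∀ i, ℓ i (r x) = (1 - m x)⁻¹ * (ℓ i x - m x) := fun i ↦ by
      simp only [r]
      rw [hℓc i _ _ _ (by ring)]
      field_simp
      ring
    refine ⟨⟨hS _ _ _ hx.1 (by ring), fun i ↦ ?_⟩, ?_⟩
    · rw [key]
      have := hmle x i
      exact mul_nonneg (by positivity) (by linarith)
    · obtain ⟨i, hi⟩ := hmex x
      exact ⟨i, by rw [key, hi]; simp⟩
  -- The factor `2` ends the contraction already at `m = 1/2`, so `F` is constant near the points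
  -- with `m ≥ 1`, where `r` is of no use.
  let τ : V → unitInterval := fun x ↦ projIcc 0 1 zero_le_one (2 * m x)
  have hτ : Continuous τ := continuous_projIcc.comp (by fun_prop)
  let F : V → Y := fun x ↦ if m x < 1 then H (τ x, f (r x)) else y₀
  refine ⟨F, fun x hx ↦ ?_, fun x hx ⟨i, hi⟩ ↦ ?_⟩
  · by_cases h1 : m x < 1
    · have hopen : {x | m x < 1} ∈ 𝓝 x := (isOpen_lt hm continuous_const).mem_nhds h1
      have hrc : ContinuousWithinAt r {x | x ∈ S ∧ ∀ i, 0 ≤ ℓ i x} x := by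
        apply ContinuousAt.continuousWithinAt
        have : ContinuousAt (fun x ↦ (1 - m x)⁻¹) x :=
          ContinuousAt.inv₀ (by fun_prop) (by linarith)
        fun_prop
      have h2 : ContinuousWithinAt (fun x ↦ f (r x))
          ({x | x ∈ S ∧ ∀ i, 0 ≤ ℓ i x} ∩ {x | m x < 1}) x :=
        (hf (r x) (hr x hx h1)).comp (hrc.mono inter_subset_left) fun y hy ↦ hr y hy.1 hy.2
      have h3 : ContinuousWithinAt (fun x ↦ f (r x)) {x | x ∈ S ∧ ∀ i, 0 ≤ ℓ i x} x :=
        (continuousWithinAt_inter hopen).1 h2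
      have h4 : ContinuousWithinAt (fun x ↦ H (τ x, f (r x))) {x | x ∈ S ∧ ∀ i, 0 ≤ ℓ i x} x :=
        H.continuous.continuousAt.comp_continuousWithinAt
          (hτ.continuousAt.continuousWithinAt.prodMk h3)
      refine h4.congr_of_eventuallyEq ?_ (if_pos h1)
      filter_upwards [mem_nhdsWithin_of_mem_nhds hopen] with y hy using if_pos hy
    · apply ContinuousAt.continuousWithinAt
      have hopen : {x | 1 / 2 < m x} ∈ 𝓝 x :=
        (isOpen_lt continuous_const hm).mem_nhds (show 1 / 2 < m x by linarith)
      refine continuousAt_const (y := y₀) |>.congr ?_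
      filter_upwards [hopen] with y hy
      simp only [F]
      split_ifs
      · have : τ y = 1 := projIcc_of_right_le _ (by change 1 / 2 < m y at hy; linarith)
        rw [this, H.apply_one]
        rfl
      · rfl
  · have h0 : m x = 0 := le_antisymm (hi ▸ hmle x i) (Finset.le_inf' _ _ fun i _ ↦ hx.2 i)
    have h1 : r x = x := by simp [r, h0]
    have h2 : τ x = 0 := projIcc_of_le_left _ (by simp [h0])
    simp only [F, h0, h1, h2, zero_lt_one, if_true, H.apply_zero]
    rfl

/-- The version of `exists_extension_of_contractible` for maps defined on the subtype `X`. -/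
theorem exists_continuousMap_extension {V Y ι : Type*} [TopologicalSpace V] [AddCommGroup V]
    [Module ℝ V] [ContinuousAdd V] [ContinuousSMul ℝ V] [TopologicalSpace Y] [ContractibleSpace Y]
    [Fintype ι] [Nonempty ι] (X S : Set V) (c : V) (ℓ : ι → V → ℝ) (hℓ : ∀ i, Continuous (ℓ i))
    (hX : ∀ x, x ∈ X ↔ x ∈ S ∧ ∀ i, 0 ≤ ℓ i x)
    (hℓc : ∀ i (a b : ℝ) x, a + b = 1 → ℓ i (a • x + b • c) = a * ℓ i x + b)
    (hS : ∀ (a b : ℝ) x, x ∈ S → a + b = 1 → a • x + b • c ∈ S)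
    (f : X → Y) (hf : ContinuousOn f {x | ∃ i, ℓ i x.1 = 0}) :
    ∃ F : C(X, Y), ∀ x : X, (∃ i, ℓ i x.1 = 0) → F x = f x := by
  classical
  have : Nonempty Y := inferInstance
  let f' : V → Y := fun x ↦ if h : x ∈ X then f ⟨x, h⟩ else Classical.arbitrary Y
  have hf' : ∀ x : X, f' x = f x := fun x ↦ dif_pos x.2
  obtain ⟨F, hF, hFf⟩ := exists_extension_of_contractible S c ℓ hℓ hℓc hS f' (by
    have h1 : ContinuousOn f' ((↑) '' {x : X | ∃ i, ℓ i x.1 = 0}) :=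
      IsInducing.subtypeVal.continuousOn_image_iff.2 (hf.congr fun x _ ↦ hf' x)
    exact h1.mono fun x hx ↦ ⟨⟨x, (hX x).2 hx.1⟩, hx.2, rfl⟩)
  refine ⟨⟨fun x ↦ F x, ?_⟩, fun x hx ↦ ?_⟩
  · exact hF.comp_continuous continuous_subtype_val fun x ↦ (hX _).1 x.2
  · exact (hFf x ((hX _).1 x.2) hx).trans (hf' x)


end Topology

/-! ### Maps out of `∂Δ[n]` as continuous maps on the boundary of the simplex -/

section BoundaryExtension

open Set Topology Simplicial Opposite

universe w

/-- For a nonempty set `s` of vertices there is a monotone retraction onto `s`. -/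
theorem exists_orderHom_retraction {n : ℕ} (s : Set (Fin (n + 1))) (hs : s.Nonempty) :
    ∃ ρ : Fin (n + 1) →o Fin (n + 1), (∀ i, ρ i ∈ s) ∧ ∀ i ∈ s, ρ i = i := by
  classical
  let t : Finset (Fin (n + 1)) := s.toFinset
  have ht : t.Nonempty := by simpa [t] using hs
  -- The largest element of `s` below `i`, or the least element of `s` if there is none.
  let ρ : Fin (n + 1) → Fin (n + 1) := fun i ↦
    if h : (t.filter (· ≤ i)).Nonempty then (t.filter (· ≤ i)).max' h else t.min' ht
  have hmem : ∀ i, ρ i ∈ t := fun i ↦ by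
    simp only [ρ]
    split_ifs with h
    · exact (Finset.mem_filter.1 (Finset.max'_mem _ h)).1
    · exact Finset.min'_mem _ _
  refine ⟨⟨ρ, fun i j hij ↦ ?_⟩, fun i ↦ Set.mem_toFinset.1 (hmem i), fun i hi ↦ ?_⟩
  · by_cases h : (t.filter (· ≤ i)).Nonempty
    · have hsub : t.filter (· ≤ i) ⊆ t.filter (· ≤ j) :=
        Finset.monotone_filter_right _ fun k _ hk ↦ le_trans hk hij
      simp only [ρ, dif_pos h, dif_pos (h.mono hsub)]
      exact Finset.max'_subset h hsub
    · have : ρ i = t.min' ht := dif_neg h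
      rw [this]
      exact Finset.min'_le _ _ (hmem j)
  · have hi' : i ∈ t.filter (· ≤ i) := by simpa [t] using hi
    have h : (t.filter (· ≤ i)).Nonempty := ⟨i, hi'⟩
    change ρ i = i
    simp only [ρ, dif_pos h]
    exact le_antisymm ((Finset.mem_filter.1 (Finset.max'_mem _ h)).2) (Finset.le_max' _ _ hi')

theorem stdSimplex_map_eq_self {n : ℕ} (ρ : Fin (n + 1) → Fin (n + 1))
    (p : stdSimplex ℝ (Fin (n + 1))) (h : ∀ i, p i ≠ 0 → ρ i = i) : stdSimplex.map ρ p = p := by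
  classical
  apply stdSimplex.ext
  ext j
  rw [stdSimplex.map_coe, FunOnFinite.linearMap_apply_apply]
  have : ∀ i, p i ≠ 0 → (ρ i = j ↔ i = j) := fun i hi ↦ by rw [h i hi]
  rw [Finset.sum_filter, Finset.sum_eq_single j]
  · by_cases hj : p j = 0
    · split_ifs
      · rfl
      · exact hj.symm
    · exact if_pos (h j hj)
  · intro i _ hij
    by_cases hi : p i = 0
    · split_ifs
      · exact hi
      · rfl
    · exact if_neg fun h' ↦ hij ((this i hi).1 h')
  · simp

theorem stdSimplex_map_apply_eq_zero {n m : ℕ} (k : Fin (m + 1) → Fin (n + 1))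
    (q : stdSimplex ℝ (Fin (m + 1))) (i : Fin (n + 1)) (h : ∀ j, k j ≠ i) :
    stdSimplex.map k q i = 0 := by
  classical
  rw [stdSimplex.map_coe, FunOnFinite.linearMap_apply_apply]
  exact Finset.sum_eq_zero fun j hj ↦ (h j (Finset.mem_filter.1 hj).2).elim

/-- A map from the boundary `∂Δ[n]` to the singular simplicial set of `Z`, given on the `m`-simplices
by `t`, comes from a continuous map on the boundary of the topological simplex. -/
theorem exists_continuousOn_boundary {n : ℕ} {Z : TopCat.{w}} [Nonempty Z]
    (t : (∂Δ[n] : SSet.{w}) ⟶ TopCat.toSSet.obj Z) :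
    ∃ f : stdSimplex ℝ (Fin (n + 1)) → Z, ContinuousOn f {p | ∃ i, p i = 0} ∧
      ∀ (m : ℕ) (k : (∂Δ[n] : SSet.{w}) _⦋m⦌) (q : stdSimplex ℝ (Fin (m + 1))),
        (Z.toSSetObjEquiv _ (t.app _ k)) q =
          f (stdSimplex.map (SSet.stdSimplex.objEquiv k.1).toOrderHom q) := by
  classical
  have hsupp : ∀ p : stdSimplex ℝ (Fin (n + 1)), {i | p i ≠ 0}.Nonempty := fun p ↦ by
    by_contra! h
    have h0 : ∀ i, p i = 0 := fun i ↦ by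
      by_contra hi
      exact (h ▸ (show i ∈ {i | p i ≠ 0} from hi) : i ∈ (∅ : Set _)).elim
    simpa [h0] using stdSimplex.sum_eq_one p
  choose ρ hρ hρ' using fun p : stdSimplex ℝ (Fin (n + 1)) ↦
    exists_orderHom_retraction _ (hsupp p)
  -- simplices of the boundary given by monotone endomorphisms of `⦋n⦌`
  let T : ∀ σ : Fin (n + 1) →o Fin (n + 1), ¬ Function.Surjective σ →
      C(stdSimplex ℝ (Fin (n + 1)), Z) := fun σ hσ ↦ Z.toSSetObjEquiv (op ⦋n⦌) (t.app (op ⦋n⦌)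
        ⟨SSet.stdSimplex.objEquiv.symm (SimplexCategory.Hom.mk σ), hσ⟩)
  -- If `σ` fixes the vertices of `k`, then `k` is the pullback of the simplex `σ` along `k` itself,
  -- so naturality of `t` applies. Using endomorphisms of `⦋n⦌` avoids reindexing faces.
  have hT : ∀ {m : ℕ} (k : (∂Δ[n] : SSet.{w}) _⦋m⦌) (σ : Fin (n + 1) →o Fin (n + 1))
      (hσ : ¬ Function.Surjective σ)
      (_ : ∀ j, σ ((SSet.stdSimplex.objEquiv k.1).toOrderHom j) =
        (SSet.stdSimplex.objEquiv k.1).toOrderHom j)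
      (q : stdSimplex ℝ (Fin (m + 1))),
      (Z.toSSetObjEquiv _ (t.app _ k)) q =
          T σ hσ (stdSimplex.map (SSet.stdSimplex.objEquiv k.1).toOrderHom q) := by
    intro m k σ hσ h q
    have hk : k = (∂Δ[n] : SSet.{w}).map (SSet.stdSimplex.objEquiv k.1).op
        (⟨SSet.stdSimplex.objEquiv.symm (SimplexCategory.Hom.mk σ), hσ⟩ :
          (∂Δ[n] : SSet.{w}).obj (op ⦋n⦌)) := by
      apply Subtype.ext
      apply SSet.stdSimplex.objEquiv.injective
      apply SimplexCategory.Hom.ext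
      apply OrderHom.ext
      funext j
      exact (h j).symm
    have h2 := ConcreteCategory.congr_hom (t.naturality (SSet.stdSimplex.objEquiv k.1).op)
      (⟨SSet.stdSimplex.objEquiv.symm (SimplexCategory.Hom.mk σ), hσ⟩ :
          (∂Δ[n] : SSet.{w}).obj (op ⦋n⦌))
    conv_lhs => rw [hk]
    refine (congr_arg (fun z ↦ Z.toSSetObjEquiv _ z q) h2).trans ?_
    rfl
  have hns : ∀ (p : stdSimplex ℝ (Fin (n + 1))) (i : Fin (n + 1)), p i = 0 →
      ¬ Function.Surjective (ρ p) := fun p i hi hs ↦ by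
    obtain ⟨j, hj⟩ := hs i
    exact hρ p j (hj ▸ hi)
  let f : stdSimplex ℝ (Fin (n + 1)) → Z := fun p ↦
    if h : ¬ Function.Surjective (ρ p) then T (ρ p) h p else Classical.arbitrary Z
  -- The value at `p` does not depend on the retraction `ρ p`: any non-surjective `σ` fixing the
  -- support of `p` gives the same.
  have hf : ∀ (p : stdSimplex ℝ (Fin (n + 1))) (σ : Fin (n + 1) →o Fin (n + 1))
      (hσ : ¬ Function.Surjective σ) (_ : ∀ i, p i ≠ 0 → σ i = i)
      (_ : ∃ i, p i = 0), f p = T σ hσ p := by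
    rintro p σ hσ h ⟨i, hi⟩
    simp only [f, dif_pos (hns p i hi)]
    refine (hT (⟨SSet.stdSimplex.objEquiv.symm (SimplexCategory.Hom.mk (ρ p)), hns p i hi⟩ :
          (∂Δ[n] : SSet.{w}).obj (op ⦋n⦌)) σ hσ (fun j ↦ h _ (hρ p j)) p).trans ?_
    congr 1
    exact stdSimplex_map_eq_self _ _ (hρ' p)
  refine ⟨f, ?_, fun m k q ↦ ?_⟩
  -- Finitely many closed faces cover the boundary, and on the face `p i = 0` a single retraction
  -- onto the complement of `i` computes `f`.
  · let A : Fin (n + 1) → Set (stdSimplex ℝ (Fin (n + 1))) := fun i ↦ {p | p i = 0}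
    have : {p | ∃ i, p i = 0} = ⋃ i, A i := by
      ext
      simp [A]
    rw [this]
    refine (locallyFinite_of_finite _).continuousOn_iUnion (fun i ↦ ?_) fun i ↦ ?_
    · exact isClosed_eq ((continuous_apply i).comp continuous_subtype_val) continuous_const
    · intro p (hp : p i = 0)
      have hne : ({i}ᶜ : Set (Fin (n + 1))).Nonempty :=
        Set.Nonempty.mono (fun j (hj : p j ≠ 0) (hji : j = i) ↦ hj (hji ▸ hp)) (hsupp p)
      obtain ⟨σ, h1, h2⟩ := exists_orderHom_retraction _ hne
      have hσ : ¬ Function.Surjective σ := fun hs ↦ by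
        obtain ⟨j, hj⟩ := hs i
        exact h1 j hj
      refine (T σ hσ).continuous.continuousWithinAt.congr (fun q hq ↦ ?_) ?_
      · exact hf q σ hσ (fun j hj ↦ h2 j fun hji ↦ hj (hji ▸ hq)) ⟨i, hq⟩
      · exact hf p σ hσ (fun j hj ↦ h2 j fun hji ↦ hj (hji ▸ hp)) ⟨i, hp⟩
  · let κ := (SSet.stdSimplex.objEquiv k.1).toOrderHom
    obtain ⟨σ, h1, h2⟩ := exists_orderHom_retraction (Set.range κ) (Set.range_nonempty _)
    have hk : ¬ Function.Surjective κ := k.2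
    have hσ : ¬ Function.Surjective σ := fun hs ↦ hk fun i ↦ by
      obtain ⟨j, rfl⟩ := hs i
      exact h1 j
    have hz : ∀ i, i ∉ Set.range κ → stdSimplex.map κ q i = 0 := fun i hi ↦
      stdSimplex_map_apply_eq_zero _ _ _ fun j hj ↦ hi ⟨j, hj⟩
    have hz' : ∃ i, i ∉ Set.range κ := by
      by_contra! h
      exact hk h
    rw [hT k σ hσ (fun j ↦ h2 _ ⟨j, rfl⟩) q]
    refine (hf _ σ hσ (fun i hi ↦ h2 i ?_) (hz'.imp hz)).symm
    by_contra h
    exact hi (hz i h)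

end BoundaryExtension

/-! ### Lifting against boundary inclusions, in terms of simplices -/

section SingularLifting

open Set Topology Simplicial Opposite SSet.modelCategoryQuillen

universe w


theorem toSSet_ext {X : SSet.{w}} {Z : TopCat.{w}} {s t : X ⟶ TopCat.toSSet.obj Z}
    (h : ∀ (m : ℕ) (k : X _⦋m⦌), Z.toSSetObjEquiv _ (s.app _ k) = Z.toSSetObjEquiv _ (t.app _ k)) :
    s = t := by
  ext ⟨m⟩ k
  induction m using SimplexCategory.rec with | _ m
  exact (Z.toSSetObjEquiv _).injective (h m k)

theorem yonedaEquiv_symm_app {X : SSet.{w}} {n m : ℕ} (x : X _⦋n⦌) (k : (Δ[n] : SSet.{w}) _⦋m⦌) :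
    (SSet.yonedaEquiv.symm x).app _ k = X.map (SSet.stdSimplex.objEquiv k).op x := by
  obtain ⟨f, rfl⟩ := SSet.stdSimplex.objEquiv.symm.surjective k
  exact SSet.yonedaEquiv_symm_app_objEquiv_symm _ _

/-- The path space of `Y`. -/
abbrev pathSpace (Y : TopCat.{w}) : TopCat.{w} := TopCat.of C(unitInterval, Y)

/-- The evaluation of paths at both end points. -/
def pathSpaceEnds (Y : TopCat.{w}) : pathSpace Y ⟶ TopCat.of (Y × Y) :=
  TopCat.ofHom ⟨fun γ ↦ (γ 0, γ 1), by fun_prop⟩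

theorem rlp_I_of_forall {X T : SSet.{w}} (p : X ⟶ T)
    (h : ∀ (n : ℕ) (t : (∂Δ[n] : SSet.{w}) ⟶ X) (b : T _⦋n⦌),
      (∀ (m : ℕ) (k : (∂Δ[n] : SSet.{w}) _⦋m⦌),
        p.app _ (t.app _ k) = T.map (SSet.stdSimplex.objEquiv k.1).op b) →
      ∃ x : X _⦋n⦌, p.app _ x = b ∧ ∀ (m : ℕ) (k : (∂Δ[n] : SSet.{w}) _⦋m⦌),
        X.map (SSet.stdSimplex.objEquiv k.1).op x = t.app _ k) : I.rlp p := by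
  rintro _ _ _ ⟨n⟩
  refine ⟨fun {t b} sq ↦ ?_⟩
  obtain ⟨x, hx, hx'⟩ := h n t (SSet.yonedaEquiv b) fun m k ↦ by
    have := ConcreteCategory.congr_hom (NatTrans.congr_app sq.w (op ⦋m⦌)) k
    refine this.trans ?_
    rw [← yonedaEquiv_symm_app, Equiv.symm_apply_apply]
    rfl
  refine ⟨⟨⟨SSet.yonedaEquiv.symm x, ?_, ?_⟩⟩⟩
  · ext ⟨m⟩ k
    induction m using SimplexCategory.rec with | _ m
    exact (yonedaEquiv_symm_app x k.1).trans (hx' m k)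
  · apply SSet.yonedaEquiv.injective
    rw [SSet.yonedaEquiv_comp, Equiv.apply_symm_apply, hx]

theorem exists_of_rlp_I {X T : SSet.{w}} {p : X ⟶ T} (hp : I.rlp p) {n : ℕ}
    (t : (∂Δ[n] : SSet.{w}) ⟶ X) (b : T _⦋n⦌)
    (h : ∀ (m : ℕ) (k : (∂Δ[n] : SSet.{w}) _⦋m⦌),
      p.app _ (t.app _ k) = T.map (SSet.stdSimplex.objEquiv k.1).op b) :
    ∃ x : X _⦋n⦌, p.app _ x = b ∧ ∀ (m : ℕ) (k : (∂Δ[n] : SSet.{w}) _⦋m⦌),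
      X.map (SSet.stdSimplex.objEquiv k.1).op x = t.app _ k := by
  have sq : CommSq t (∂Δ[n] : SSet.Subcomplex _).ι p (SSet.yonedaEquiv.symm b) := ⟨by
    ext ⟨m⟩ k
    induction m using SimplexCategory.rec with | _ m
    exact (h m k).trans (yonedaEquiv_symm_app b k.1).symm⟩
  have : HasLiftingProperty (∂Δ[n] : SSet.Subcomplex.{w} _).ι p := hp _ (boundary_ι_mem_I n)
  refine ⟨SSet.yonedaEquiv sq.lift, ?_, fun m k ↦ ?_⟩
  · rw [← SSet.yonedaEquiv_comp, sq.fac_right, Equiv.apply_symm_apply]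
  · rw [← yonedaEquiv_symm_app, Equiv.symm_apply_apply]
    exact ConcreteCategory.congr_hom (NatTrans.congr_app sq.fac_left (op ⦋m⦌)) k

end SingularLifting

/-! ### Trivial fibrations of singular sets over contractible spaces -/

section SingularLifting

open Set Topology Simplicial Opposite SSet.modelCategoryQuillen

universe w

theorem exists_simplex_extension {Y : Type*} [TopologicalSpace Y] [ContractibleSpace Y] {n : ℕ}
    (f : stdSimplex ℝ (Fin (n + 1)) → Y) (hf : ContinuousOn f {p | ∃ i, p i = 0}) :
    ∃ F : C(stdSimplex ℝ (Fin (n + 1)), Y), ∀ p, (∃ i, p i = 0) → F p = f p := by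
  have hn : (n + 1 : ℝ) ≠ 0 := by positivity
  have hiff : ∀ x : ℝ, (n + 1 : ℝ) * x = 0 ↔ x = 0 := fun x ↦ by simp [hn]
  -- The centre is the barycentre; the factor `n + 1` normalizes the coordinates to the value `1`
  -- there.
  obtain ⟨F, hF⟩ := exists_continuousMap_extension (stdSimplex ℝ (Fin (n + 1)))
    {v | ∑ i, v i = 1} (fun _ ↦ (n + 1 : ℝ)⁻¹) (fun i v ↦ (n + 1 : ℝ) * v i) (fun i ↦ by fun_prop)
    (fun x ↦ by
      have : ∀ i, 0 ≤ (n + 1 : ℝ) * x i ↔ 0 ≤ x i := fun i ↦ mul_nonneg_iff_of_pos_left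
        (by positivity)
      simp only [this]
      exact and_comm)
    (fun i a b x h ↦ by simp; field_simp)
    (fun a b x (hx : ∑ i, x i = 1) h ↦ by
      change ∑ i, (a * x i + b * _) = 1
      rw [Finset.sum_add_distrib, ← Finset.mul_sum, hx]
      simp
      field_simp
      linarith)
    f (hf.mono fun p ⟨i, hi⟩ ↦ ⟨i, (hiff _).1 hi⟩)
  exact ⟨F, fun p ⟨i, hi⟩ ↦ hF p ⟨i, (hiff _).2 hi⟩⟩

theorem exists_prism_extension {Y : Type*} [TopologicalSpace Y] [ContractibleSpace Y] {n : ℕ}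
    (f : stdSimplex ℝ (Fin (n + 1)) × unitInterval → Y)
    (hf : ContinuousOn f {x | (∃ i, x.1 i = 0) ∨ x.2 = 0 ∨ x.2 = 1}) :
    ∃ F : C(stdSimplex ℝ (Fin (n + 1)) × unitInterval, Y),
      ∀ x, ((∃ i, x.1 i = 0) ∨ x.2 = 0 ∨ x.2 = 1) → F x = f x := by
  have hn : (n + 1 : ℝ) ≠ 0 := by positivity
  have hiff : ∀ x : ℝ, (n + 1 : ℝ) * x = 0 ↔ x = 0 := fun x ↦ by simp [hn]
  let X : Set ((Fin (n + 1) → ℝ) × ℝ) := stdSimplex ℝ (Fin (n + 1)) ×ˢ unitInterval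
  -- Normalized to `1` at the centre (barycentre, `1/2`); the last two functions cut out the ends of
  -- the prism.
  let ℓ : Fin (n + 1) ⊕ Bool → (Fin (n + 1) → ℝ) × ℝ → ℝ := fun j v ↦ match j with
    | .inl i => (n + 1 : ℝ) * v.1 i
    | .inr true => 2 * v.2
    | .inr false => 2 * (1 - v.2)
  let e : X → stdSimplex ℝ (Fin (n + 1)) × unitInterval := fun x ↦ (⟨x.1.1, x.2.1⟩, ⟨x.1.2, x.2.2⟩)
  have he : Continuous e := by fun_prop
  have hbd : ∀ x : X, (∃ j, ℓ j x.1 = 0) ↔ ((∃ i, (e x).1 i = 0) ∨ (e x).2 = 0 ∨ (e x).2 = 1) := by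
    intro x
    rw [Sum.exists, Bool.exists_bool, or_comm (a := ℓ (.inr false) _ = 0)]
    refine or_congr (exists_congr fun i ↦ hiff _) (or_congr ?_ ?_)
    · rw [Subtype.ext_iff]
      simp [ℓ, e]
    · rw [Subtype.ext_iff]
      simp only [ℓ, e, mul_eq_zero, OfNat.ofNat_ne_zero, false_or, sub_eq_zero]
      exact eq_comm
  obtain ⟨F, hF⟩ := exists_continuousMap_extension X {v | ∑ i, v.1 i = 1}
    (fun _ ↦ (n + 1 : ℝ)⁻¹, 1 / 2) ℓ
    (fun j ↦ by rcases j with i | _ | _ <;> simp only [ℓ] <;> fun_prop)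
    (fun x ↦ by
      have : ∀ i, 0 ≤ (n + 1 : ℝ) * x.1 i ↔ 0 ≤ x.1 i := fun i ↦ mul_nonneg_iff_of_pos_left
        (by positivity)
      simp only [Sum.forall, Bool.forall_bool, ℓ, this]
      constructor
      · rintro ⟨⟨h1, h2⟩, h3, h4⟩
        exact ⟨h2, h1, by linarith, by linarith⟩
      · rintro ⟨h2, h1, h3, h4⟩
        exact ⟨⟨h1, h2⟩, by linarith, by linarith⟩)
    (fun j a b x h ↦ by
      rcases j with i | _ | _
      · simp [ℓ]; field_simp
      · simp [ℓ]; linear_combination -2 * h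
      · simp [ℓ]; ring)
    (fun a b x (hx : ∑ i, x.1 i = 1) h ↦ by
      change ∑ i, (a * x.1 i + b * _) = 1
      rw [Finset.sum_add_distrib, ← Finset.mul_sum, hx]
      simp
      field_simp
      linarith)
    (f ∘ e) (hf.comp he.continuousOn fun x hx ↦ (hbd x).1 hx)
  exact ⟨F.comp ⟨fun x ↦ ⟨(x.1.1, x.2.1), x.1.2, x.2.2⟩, by fun_prop⟩,
    fun x hx ↦ hF ⟨(x.1.1, x.2.1), x.1.2, x.2.2⟩ ((hbd _).2 hx)⟩

/-- The monotone retraction onto the support of `p` is such a simplex. It turns simplexwise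
identities on `∂Δ[n]` into pointwise ones. -/
theorem exists_boundary_simplex_map_eq_self {n : ℕ} (p : stdSimplex ℝ (Fin (n + 1)))
    (hp : ∃ i, p i = 0) : ∃ k : (∂Δ[n] : SSet.{w}) _⦋n⦌,
      stdSimplex.map (SSet.stdSimplex.objEquiv k.1).toOrderHom p = p := by
  obtain ⟨i, hi⟩ := hp
  have hsupp : {i | p i ≠ 0}.Nonempty := by
    by_contra! h
    have h0 : ∀ i, p i = 0 := fun i ↦ by
      by_contra hi
      exact (h ▸ (show i ∈ {i | p i ≠ 0} from hi) : i ∈ (∅ : Set _)).elim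
    simpa [h0] using stdSimplex.sum_eq_one p
  obtain ⟨ρ, h1, h2⟩ := exists_orderHom_retraction _ hsupp
  have hρ : ¬ Function.Surjective ρ := fun hs ↦ by
    obtain ⟨j, hj⟩ := hs i
    exact h1 j (hj ▸ hi)
  exact ⟨⟨SSet.stdSimplex.objEquiv.symm (SimplexCategory.Hom.mk ρ), hρ⟩,
    stdSimplex_map_eq_self _ _ h2⟩

/-- The singular simplicial set of a contractible space is a trivial Kan complex. -/
theorem rlp_I_toSSet_of_contractible {Y : TopCat.{w}} [ContractibleSpace Y] {T : SSet.{w}}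
    [∀ n, Subsingleton (T.obj n)] (p : TopCat.toSSet.obj Y ⟶ T) : I.rlp p := by
  refine rlp_I_of_forall p fun n t b _ ↦ ?_
  have : Nonempty Y := inferInstance
  obtain ⟨f, hf, hft⟩ := exists_continuousOn_boundary t
  obtain ⟨F, hF⟩ := exists_simplex_extension f hf
  refine ⟨(Y.toSSetObjEquiv (op ⦋n⦌)).symm F, Subsingleton.elim _ _, fun m k ↦ ?_⟩
  apply (Y.toSSetObjEquiv _).injective
  ext q
  refine Eq.trans ?_ (hft m k q).symm
  obtain ⟨i, hi⟩ : ∃ i, i ∉ Set.range (SSet.stdSimplex.objEquiv k.1).toOrderHom := by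
    by_contra! h
    exact k.2 h
  exact hF _ ⟨i, stdSimplex_map_apply_eq_zero _ _ _ fun j hj ↦ hi ⟨j, hj⟩⟩

/-- For a contractible space `Y`, the map from the path space to `Y × Y` induces a trivial
fibration of singular simplicial sets. -/
theorem rlp_I_toSSet_pathSpaceEnds {Y : TopCat.{w}} [ContractibleSpace Y] :
    I.rlp (TopCat.toSSet.map (pathSpaceEnds Y)) := by
  classical
  refine rlp_I_of_forall _ fun n t b htb ↦ ?_
  have : Nonempty Y := inferInstance
  have : Nonempty (pathSpace Y) := ⟨ContinuousMap.const _ (Classical.arbitrary Y)⟩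
  obtain ⟨f, hf, hft⟩ := exists_continuousOn_boundary t
  let β : C(stdSimplex ℝ (Fin (n + 1)), Y × Y) := (TopCat.of (Y × Y)).toSSetObjEquiv (op ⦋n⦌) b
  have hfβ : ∀ p : stdSimplex ℝ (Fin (n + 1)), (∃ i, p i = 0) →
      ((f p : C(unitInterval, Y)) 0, (f p : C(unitInterval, Y)) 1) = β p := by
    intro p hp
    obtain ⟨k, hk⟩ := exists_boundary_simplex_map_eq_self.{w} p hp
    have h1 := hft n k p
    have h2 := congr_arg (fun z ↦ (TopCat.of (Y × Y)).toSSetObjEquiv _ z p) (htb n k)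
    rw [hk] at h1
    rw [← h1]
    refine h2.trans ?_
    change β (stdSimplex.map (SSet.stdSimplex.objEquiv k.1).toOrderHom p) = β p
    rw [hk]
  -- A lift is a map on the prism: its ends are prescribed by `b` and its sides by the paths `f`,
  -- which agree on the overlap by `hfβ`.
  let g : stdSimplex ℝ (Fin (n + 1)) × unitInterval → Y := fun x ↦
    if x.2 = 0 then (β x.1).1 else if x.2 = 1 then (β x.1).2 else (f x.1 : C(unitInterval, Y)) x.2
  have hg0 : ∀ p, g (p, 0) = (β p).1 := fun p ↦ if_pos rfl
  have hg1 : ∀ p, g (p, 1) = (β p).2 := fun p ↦ by simp [g]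
  have hgf : ∀ p : stdSimplex ℝ (Fin (n + 1)), (∃ i, p i = 0) →
      ∀ s, g (p, s) = (f p : C(unitInterval, Y)) s := fun p hp s ↦ by
    simp only [g]
    split_ifs with h0 h1
    · rw [h0, ← hfβ p hp]
    · rw [h1, ← hfβ p hp]
    · rfl
  have hg : ContinuousOn g {x | (∃ i, x.1 i = 0) ∨ x.2 = 0 ∨ x.2 = 1} := by
    let A₀ : Set (stdSimplex ℝ (Fin (n + 1)) × unitInterval) := {x | x.2 = 0}
    let A₁ : Set (stdSimplex ℝ (Fin (n + 1)) × unitInterval) := {x | x.2 = 1}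
    let B : Set (stdSimplex ℝ (Fin (n + 1)) × unitInterval) := {x | ∃ i, x.1 i = 0}
    have hc0 : IsClosed A₀ := isClosed_eq continuous_snd continuous_const
    have hc1 : IsClosed A₁ := isClosed_eq continuous_snd continuous_const
    have hcb : IsClosed B := by
      simp only [B, ofPred_exists]
      exact isClosed_iUnion_of_finite fun i ↦ isClosed_eq
        ((continuous_apply i).comp (continuous_subtype_val.comp continuous_fst)) continuous_const
    change ContinuousOn g (B ∪ (A₀ ∪ A₁))
    refine ContinuousOn.union_of_isClosed ?_
      (ContinuousOn.union_of_isClosed ?_ ?_ hc0 hc1) hcb (hc0.union hc1)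
    · refine ContinuousOn.congr (f := fun x ↦ (f x.1 : C(unitInterval, Y)) x.2) ?_
        fun x hx ↦ hgf x.1 hx x.2
      have h1 : ContinuousOn (fun x ↦ ((f x.1 : C(unitInterval, Y)), x.2)) B :=
        (hf.comp continuousOn_fst fun x hx ↦ hx).prodMk continuousOn_snd
      exact ContinuousEval.continuous_eval.comp_continuousOn h1
    · refine ContinuousOn.congr (f := fun x ↦ (β x.1).1) (by fun_prop) ?_
      rintro ⟨p, s⟩ (rfl : s = 0)
      exact hg0 p
    · refine ContinuousOn.congr (f := fun x ↦ (β x.1).2) (by fun_prop) ?_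
      rintro ⟨p, s⟩ (rfl : s = 1)
      exact hg1 p
  obtain ⟨F, hF⟩ := exists_prism_extension g hg
  refine ⟨((pathSpace Y).toSSetObjEquiv (op ⦋n⦌)).symm F.curry, ?_, fun m k ↦ ?_⟩
  · apply ((TopCat.of (Y × Y)).toSSetObjEquiv _).injective
    ext p
    · exact (hF (p, 0) (.inr (.inl rfl))).trans (hg0 p)
    · exact (hF (p, 1) (.inr (.inr rfl))).trans (hg1 p)
  · apply ((pathSpace Y).toSSetObjEquiv _).injective
    ext q s
    obtain ⟨i, hi⟩ : ∃ i, i ∉ Set.range (SSet.stdSimplex.objEquiv k.1).toOrderHom := by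
      by_contra! h
      exact k.2 h
    have h0 : ∃ i, stdSimplex.map (SSet.stdSimplex.objEquiv k.1).toOrderHom q i = 0 :=
      ⟨i, stdSimplex_map_apply_eq_zero _ _ _ fun j hj ↦ hi ⟨j, hj⟩⟩
    exact (hF (_, s) (.inl h0)).trans <| (hgf _ h0 s).trans
      (congr_arg (fun γ : C(unitInterval, Y) ↦ γ s) (hft m k q).symm)

end SingularLifting

/-! ### Homotopies from lifts to the path space -/

section Homotopy

universe w

/-- A map to the singular simplicial set of the path space of `Y` gives a homotopy. -/
theorem homotopic_of_lift_pathSpace {S : SSet.{w}} {Y : TopCat.{w}} (f g : SSet.toTop.obj S ⟶ Y)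
    (γ : S ⟶ TopCat.toSSet.obj (pathSpace Y))
    (hγ : γ ≫ TopCat.toSSet.map (pathSpaceEnds Y) =
      sSetTopAdj.homEquiv S (TopCat.of (Y × Y)) (TopCat.ofHom (f.hom.prodMk g.hom))) :
    f.hom.Homotopic g.hom := by
  let Γ := (sSetTopAdj.homEquiv S (pathSpace Y)).symm γ
  have hΓ : Γ ≫ pathSpaceEnds Y = TopCat.ofHom (f.hom.prodMk g.hom) := by
    rw [← sSetTopAdj.homEquiv_naturality_right_symm, hγ, Equiv.symm_apply_apply]
  let c : C(SSet.toTop.obj S, C(unitInterval, Y)) := Γ.hom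
  have h := fun x ↦ ConcreteCategory.congr_hom hΓ x
  refine ⟨⟨⟨fun p ↦ c p.2 p.1, ?_⟩, fun x ↦ congr_arg Prod.fst (h x),
    fun x ↦ congr_arg Prod.snd (h x)⟩⟩
  exact (ContinuousMap.continuous_uncurry_of_continuous c).comp continuous_swap

end Homotopy

/-! ### Total simplicial sets of local systems on a groupoid -/

section Twisted

open Opposite Simplicial SSet.modelCategoryQuillen

variable {D : Type u} [Groupoid.{max u v} D]

/-- The arrow from the initial vertex of `τ` to the initial vertex of its image under a
simplicial operator. -/
def firstArrow {n m : SimplexCategoryᵒᵖ} (θ : n ⟶ m) (τ : (nerve D).obj n) :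
    τ.obj 0 ⟶ ((nerve D).map θ τ).obj 0 :=
  τ.map (homOfLE (Fin.zero_le (θ.unop.toOrderHom 0)))

theorem map_id_app_apply (L : D ⥤ SSet.{max u v}) (d : D) {n : SimplexCategoryᵒᵖ}
    (y : (L.obj d).obj n) : (L.map (𝟙 d)).app n y = y := by
  rw [L.map_id]
  rfl

theorem map_comp_app_apply (L : D ⥤ SSet.{max u v}) {d d' d'' : D} (f : d ⟶ d') (g : d' ⟶ d'')
    {n : SimplexCategoryᵒᵖ} (y : (L.obj d).obj n) :
    (L.map (f ≫ g)).app n y = (L.map g).app n ((L.map f).app n y) := by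
  rw [L.map_comp]
  rfl

/-- The total simplicial set over the nerve of a groupoid `D` of a local system `L` of simplicial
sets on `D`. -/
def twisted (L : D ⥤ SSet.{max u v}) : SSet.{max u v} where
  obj n := Σ τ : (nerve D).obj n, (L.obj (τ.obj 0)).obj n
  map θ := ↾fun x ↦ ⟨(nerve D).map θ x.1,
    (L.map (firstArrow θ x.1)).app _ ((L.obj _).map θ x.2)⟩
  map_id n := by
    refine ConcreteCategory.hom_ext _ _ fun x ↦ ?_
    -- The base components agree definitionally, so writing both sides as pairs leaves only an
    -- equation in a single fibre.
    refine @id (@Eq (Sigma fun τ : (nerve D).obj _ ↦ (L.obj (τ.obj 0)).obj _) ⟨_, _⟩ ⟨_, _⟩) ?_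
    refine congr_arg (Sigma.mk _) ?_
    have h1 : (L.obj (x.1.obj 0)).map (𝟙 n) x.2 = x.2 := by simp
    have h2 : firstArrow (𝟙 n) x.1 = 𝟙 (x.1.obj 0) := x.1.map_id 0
    rw [h1]
    refine Eq.trans ?_ (map_id_app_apply L _ x.2)
    exact congr_arg (fun f ↦ (L.map f).app n x.2) h2
  map_comp {n m l} θ θ' := by
    refine ConcreteCategory.hom_ext _ _ fun x ↦ ?_
    refine @id (@Eq (Sigma fun τ : (nerve D).obj _ ↦ (L.obj (τ.obj 0)).obj _) ⟨_, _⟩ ⟨_, _⟩) ?_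
    refine congr_arg (Sigma.mk _) ?_
    change (L.map (firstArrow (θ ≫ θ') x.1)).app _ _ = (L.map (firstArrow θ' _)).app _
      ((L.obj _).map θ' ((L.map (firstArrow θ x.1)).app _ ((L.obj _).map θ x.2)))
    have h1 : firstArrow (θ ≫ θ') x.1 = firstArrow θ x.1 ≫ firstArrow θ' ((nerve D).map θ x.1) :=
      x.1.map_comp (homOfLE _) (homOfLE _)
    have h2 := ConcreteCategory.congr_hom ((L.map (firstArrow θ x.1)).naturality θ')
      ((L.obj _).map θ x.2)
    have h3 : (L.obj (x.1.obj 0)).map (θ ≫ θ') x.2 = (L.obj _).map θ' ((L.obj _).map θ x.2) := by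
      simp
    rw [h3]
    refine Eq.trans (congr_arg (fun f ↦ (L.map f).app l _) h1) ?_
    refine (map_comp_app_apply L _ _ _).trans (congr_arg _ h2)

namespace twisted

variable (L : D ⥤ SSet.{max u v})

/-- The projection to the nerve. -/
def proj : twisted L ⟶ nerve D where
  app n := ↾fun x ↦ x.1

variable {L} {L' : D ⥤ SSet.{max u v}}

/-- The functoriality of `twisted`. -/
def map (α : L ⟶ L') : twisted L ⟶ twisted L' where
  app n := ↾fun x ↦ ⟨x.1, (α.app _).app n x.2⟩
  naturality n m θ := by
    refine ConcreteCategory.hom_ext _ _ fun x ↦ ?_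
    refine @id (@Eq (Sigma fun τ : (nerve D).obj _ ↦ (L'.obj (τ.obj 0)).obj _) ⟨_, _⟩ ⟨_, _⟩) ?_
    refine congr_arg (Sigma.mk _) ?_
    have h1 := ConcreteCategory.congr_hom (NatTrans.congr_app (α.naturality (firstArrow θ x.1)) m)
      ((L.obj _).map θ x.2)
    have h2 := ConcreteCategory.congr_hom ((α.app (x.1.obj 0)).naturality θ) x.2
    exact h1.trans (congr_arg _ h2)

/-- The map from `twisted L` induced by a cocone under `L`. -/
def desc {B : SSet.{max u v}} (c : L ⟶ (Functor.const D).obj B) : twisted L ⟶ B where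
  app n := ↾fun x ↦ (c.app _).app n x.2
  naturality n m θ := by
    ext x
    have h1 := ConcreteCategory.congr_hom (NatTrans.congr_app (c.naturality (firstArrow θ x.1)) m)
      ((L.obj _).map θ x.2)
    have h2 := ConcreteCategory.congr_hom ((c.app (x.1.obj 0)).naturality θ) x.2
    exact h1.trans h2

theorem map_comp_desc {B : SSet.{max u v}} (α : L ⟶ L') (c : L' ⟶ (Functor.const D).obj B) :
    map α ≫ desc c = desc (α ≫ c) := rfl

theorem desc_comp {B B' : SSet.{max u v}} (c : L ⟶ (Functor.const D).obj B) (g : B ⟶ B') :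
    desc c ≫ g = desc (c ≫ (Functor.const D).map g) := rfl

/-- Transport of the fibre component of `x` along an arrow to the initial vertex of `x`. -/
def untwist {n : SimplexCategoryᵒᵖ} (x : (twisted L).obj n) {τ : (nerve D).obj n} (h : x.1 = τ)
    {d : D} (γ : d ⟶ τ.obj 0) : (L.obj d).obj n :=
  (L.map (Groupoid.inv γ)).app n (h ▸ x.2)

/-- The transports along `firstArrow` cancel, so simplicial operators act only through `L.obj d`.
Over a fixed simplex the total object thus becomes a product with one fibre, because all arrows of
`D` are invertible. -/
theorem untwist_map {n m : SimplexCategoryᵒᵖ} (θ : n ⟶ m) (x : (twisted L).obj n)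
    {τ : (nerve D).obj n} (h : x.1 = τ) {d : D} (γ : d ⟶ τ.obj 0)
    (h' : ((twisted L).map θ x).1 = (nerve D).map θ τ) :
    untwist ((twisted L).map θ x) h' (γ ≫ firstArrow θ τ) = (L.obj d).map θ (untwist x h γ) := by
  subst h
  have h1 := ConcreteCategory.congr_hom ((L.map (Groupoid.inv γ)).naturality θ) x.2
  refine Eq.trans ?_ h1
  change (L.map (Groupoid.inv (γ ≫ firstArrow θ x.1))).app m
    ((L.map (firstArrow θ x.1)).app m ((L.obj _).map θ x.2)) = _
  have h2 : L.map (firstArrow θ x.1) ≫ L.map (Groupoid.inv (γ ≫ firstArrow θ x.1)) =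
      L.map (Groupoid.inv γ) := by
    rw [← L.map_comp]
    simp [Groupoid.inv_eq_inv]
  exact ConcreteCategory.congr_hom (NatTrans.congr_app h2 m) _

theorem untwist_congr {n : SimplexCategoryᵒᵖ} {x y : (twisted L).obj n} (hxy : x = y)
    {τ : (nerve D).obj n} (hx : x.1 = τ) (hy : y.1 = τ) {d : D} {γ γ' : d ⟶ τ.obj 0}
    (hγ : γ = γ') : untwist x hx γ = untwist y hy γ' := by
  subst hxy hγ
  rfl

theorem untwist_app_map {n : SimplexCategoryᵒᵖ} (α : L ⟶ L') (x : (twisted L).obj n)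
    {τ : (nerve D).obj n} (h : x.1 = τ) {d : D} (γ : d ⟶ τ.obj 0) :
    untwist ((map α).app n x) h γ = (α.app d).app n (untwist x h γ) := by
  subst h
  exact (ConcreteCategory.congr_hom (NatTrans.congr_app (α.naturality (Groupoid.inv γ)) n) x.2).symm

theorem ext_untwist {n : SimplexCategoryᵒᵖ} {x y : (twisted L).obj n} {τ : (nerve D).obj n}
    (hx : x.1 = τ) (hy : y.1 = τ) {d : D} (γ : d ⟶ τ.obj 0)
    (h : untwist x hx γ = untwist y hy γ) : x = y := by
  obtain ⟨x₁, x₂⟩ := x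
  obtain ⟨y₁, y₂⟩ := y
  obtain rfl : x₁ = τ := hx
  obtain rfl : y₁ = x₁ := hy
  refine Sigma.ext rfl (heq_of_eq ?_)
  have h1 := congr_arg ((L.map γ).app n) h
  have h2 : L.map (Groupoid.inv γ) ≫ L.map γ = 𝟙 _ := by
    rw [← L.map_comp]
    simp [Groupoid.inv_eq_inv]
  have h3 := fun z ↦ ConcreteCategory.congr_hom (NatTrans.congr_app h2 n) z
  exact (h3 x₂).symm.trans (h1.trans (h3 y₂))

theorem untwist_self {n : SimplexCategoryᵒᵖ} (τ : (nerve D).obj n)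
    (y : (L.obj (τ.obj 0)).obj n) :
    untwist (L := L) ⟨τ, y⟩ rfl (𝟙 (τ.obj 0)) = y := by
  change (L.map (Groupoid.inv (𝟙 _))).app n y = y
  simp [Groupoid.inv_eq_inv]

/-- A transformation of local systems which is a trivial fibration on each fibre induces a
trivial fibration of total simplicial sets. -/
theorem rlp_I_map (α : L ⟶ L') (hα : ∀ d, I.rlp (α.app d)) : I.rlp (map α) := by
  refine rlp_I_of_forall _ fun n t b hb ↦ ?_
  obtain ⟨τ, y'⟩ := b
  have hbase : ∀ {m : SimplexCategoryᵒᵖ} (k : (∂Δ[n] : SSet.{max u v}).obj m),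
      (t.app m k).1 = (nerve D).map (SSet.stdSimplex.objEquiv k.1).op τ := fun {m} k ↦ by
    obtain ⟨m⟩ := m
    induction m using SimplexCategory.rec with | _ m
    exact congr_arg Sigma.fst (hb m k)
  -- The lifting problem is carried into the one fibre over the initial vertex of `τ`. The leading
  -- `𝟙 _` gives the arrow the shape required by `untwist_map`.
  let t' : (∂Δ[n] : SSet.{max u v}) ⟶ L.obj (τ.obj 0) :=
    { app m := ↾fun k ↦ untwist (t.app m k) (hbase k)
        (𝟙 _ ≫ firstArrow (SSet.stdSimplex.objEquiv k.1).op τ)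
      naturality m l θ := by
        refine ConcreteCategory.hom_ext _ _ fun k ↦ ?_
        have h1 := ConcreteCategory.congr_hom (t.naturality θ) k
        have h2 : 𝟙 _ ≫ firstArrow ((SSet.stdSimplex.objEquiv k.1).op ≫ θ) τ =
            (𝟙 _ ≫ firstArrow (SSet.stdSimplex.objEquiv k.1).op τ) ≫
              firstArrow θ ((nerve D).map (SSet.stdSimplex.objEquiv k.1).op τ) := by
          rw [Category.id_comp, Category.id_comp]
          exact τ.map_comp (homOfLE _) (homOfLE _)
        have h3 : (t.app l ((∂Δ[n] : SSet.{max u v}).map θ k)).1 =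
            (nerve D).map θ ((nerve D).map (SSet.stdSimplex.objEquiv k.1).op τ) := hbase _
        refine Eq.trans ?_ (untwist_map θ (t.app m k) (hbase k) _
          ((congr_arg Sigma.fst h1).symm.trans h3))
        exact untwist_congr h1 _ _ h2 }
  obtain ⟨x, hx, hx'⟩ := exists_of_rlp_I (hα (τ.obj 0)) t' y' fun m k ↦ by
    refine (untwist_app_map α _ _ _).symm.trans ?_
    refine (untwist_congr (hb m k) (hbase k) rfl rfl).trans ?_
    refine (untwist_map _ _ rfl _ rfl).trans ?_
    rw [untwist_self]
  refine ⟨⟨τ, x⟩, Sigma.ext rfl (heq_of_eq hx), fun m k ↦ ?_⟩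
  refine ext_untwist rfl (hbase k) (𝟙 _ ≫ firstArrow (SSet.stdSimplex.objEquiv k.1).op τ) ?_
  refine (untwist_map _ _ rfl _ rfl).trans ?_
  rw [untwist_self]
  exact hx' m k

end twisted
end Twisted

/-! ### Lifts over the nerve and their uniqueness up to homotopy -/

section Lifts

open Opposite Simplicial SSet.modelCategoryQuillen

universe w

/-- Lifting against boundary inclusions gives lifting against all monomorphisms, in particular
against the inclusion of the empty subcomplex of `S`. -/
theorem exists_lift_of_rlp_I {X T S : SSet.{w}} {p : X ⟶ T} (hp : I.rlp p) (g : S ⟶ T) :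
    ∃ l : S ⟶ X, l ≫ p = g := by
  rw [← SSet.rlp_monomorphisms] at hp
  have hlift : HasLiftingProperty (⊥ : S.Subcomplex).ι p :=
    hp _ (MorphismProperty.monomorphisms.infer_property _)
  have sq : CommSq (SSet.Subcomplex.isInitialBot.to X) (⊥ : S.Subcomplex).ι p g :=
    ⟨SSet.Subcomplex.isInitialBot.hom_ext _ _⟩
  exact ⟨sq.lift, sq.fac_right⟩

section

universe v' u'

variable {J : Type u'} [Category.{v'} J] (Y : J ⥤ TopCat.{w})

/-- The fibrewise path space. -/
def pathSpaceFunctor : J ⥤ TopCat.{w} where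
  obj j := pathSpace (Y.obj j)
  map f := TopCat.ofHom ⟨fun γ ↦ (Y.map f).hom.comp γ, by fun_prop⟩
  map_id j := by ext γ; simp
  map_comp f g := by ext γ; simp

/-- The fibrewise square. -/
def squareFunctor : J ⥤ TopCat.{w} where
  obj j := TopCat.of (Y.obj j × Y.obj j)
  map f := TopCat.ofHom ((Y.map f).hom.prodMap (Y.map f).hom)
  map_id j := by ext γ <;> simp
  map_comp f g := by ext γ <;> simp

/-- The fibrewise evaluation of paths at both end points. -/
def pathSpaceFunctorEnds : pathSpaceFunctor Y ⟶ squareFunctor Y where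
  app j := pathSpaceEnds (Y.obj j)

/-- The first projection. -/
def squareFunctorFst : squareFunctor Y ⟶ Y where
  app j := TopCat.ofHom ⟨Prod.fst, continuous_fst⟩

/-- The second projection. -/
def squareFunctorSnd : squareFunctor Y ⟶ Y where
  app j := TopCat.ofHom ⟨Prod.snd, continuous_snd⟩

end

variable {D : Type u} [Groupoid.{max u v} D] (Y : D ⥤ TopCat.{max u v})

/-- The cocone of singular simplicial sets induced by a cocone of spaces. -/
def singularCocone {Y : D ⥤ TopCat.{max u v}} {B : TopCat.{max u v}}
    (k : Y ⟶ (Functor.const D).obj B) :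
    Y ⋙ TopCat.toSSet ⟶ (Functor.const D).obj (TopCat.toSSet.obj B) where
  app d := TopCat.toSSet.map (k.app d)
  naturality d d' f := by
    have h := congr_arg TopCat.toSSet.map (k.naturality f)
    rw [TopCat.toSSet.map_comp, TopCat.toSSet.map_comp] at h
    exact h

/-- A pair of singular simplices. -/
def singularPair {A B : TopCat.{w}} {n : SimplexCategoryᵒᵖ} (a : (TopCat.toSSet.obj A).obj n)
    (b : (TopCat.toSSet.obj B).obj n) : (TopCat.toSSet.obj (TopCat.of (A × B))).obj n :=
  ((TopCat.of (A × B)).toSSetObjEquiv n).symm ((A.toSSetObjEquiv n a).prodMk (B.toSSetObjEquiv n b))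

variable {Y}

/-- The pair of two simplices over the same base simplex. -/
def twistedPair {n : SimplexCategoryᵒᵖ} (x y : (twisted (Y ⋙ TopCat.toSSet)).obj n)
    (h : x.1 = y.1) : (twisted (squareFunctor Y ⋙ TopCat.toSSet)).obj n :=
  ⟨x.1, singularPair x.2 (h ▸ y.2)⟩

/-- The total object of the fibrewise square is the fibre product of the total object with itself
over `nerve D`. -/
theorem exists_twisted_pair {S : SSet.{max u v}} (a b : S ⟶ twisted (Y ⋙ TopCat.toSSet))
    (hab : a ≫ twisted.proj _ = b ≫ twisted.proj _) :
    ∃ p : S ⟶ twisted (squareFunctor Y ⋙ TopCat.toSSet),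
      p ≫ twisted.map (Functor.whiskerRight (squareFunctorFst Y) _) = a ∧
      p ≫ twisted.map (Functor.whiskerRight (squareFunctorSnd Y) _) = b := by
  have h : ∀ {n : SimplexCategoryᵒᵖ} (x : S.obj n), (a.app n x).1 = (b.app n x).1 := by
    intro n x
    exact ConcreteCategory.congr_hom (NatTrans.congr_app hab n) x
  have hnat : ∀ {n m : SimplexCategoryᵒᵖ} (θ : n ⟶ m) (x y : (twisted (Y ⋙ TopCat.toSSet)).obj n)
      (x' y' : (twisted (Y ⋙ TopCat.toSSet)).obj m)
      (hx : x' = (twisted _).map θ x) (hy : y' = (twisted _).map θ y) (hxy : x.1 = y.1)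
      (hxy' : x'.1 = y'.1),
      twistedPair x' y' hxy' = (twisted _).map θ (twistedPair x y hxy) := by
    rintro n m θ ⟨τ, x⟩ ⟨τ', y⟩ x' y' rfl rfl hxy hxy'
    obtain rfl : τ = τ' := hxy
    rfl
  have hsnd : ∀ {n : SimplexCategoryᵒᵖ} (x y : (twisted (Y ⋙ TopCat.toSSet)).obj n)
      (hxy : x.1 = y.1), (twisted.map (Functor.whiskerRight (squareFunctorSnd Y) _)).app n
        (twistedPair x y hxy) = y := by
    rintro n ⟨τ, x⟩ ⟨τ', y⟩ hxy
    obtain rfl : τ = τ' := hxy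
    rfl
  refine ⟨{ app n := ↾fun x ↦ twistedPair (a.app n x) (b.app n x) (h x)
            naturality n m θ := ConcreteCategory.hom_ext _ _ fun x ↦ ?_ }, ?_, ?_⟩
  · exact hnat θ _ _ _ _ (ConcreteCategory.congr_hom (a.naturality θ) x)
      (ConcreteCategory.congr_hom (b.naturality θ) x) (h x) (h (S.map θ x))
  · ext n x
    rfl
  · ext n x
    exact hsnd _ _ (h x)

variable (hY : ∀ d, ContractibleSpace (Y.obj d))
include hY

/-- The local system constant at a point has the nerve itself as total object, and contractible
fibres make the map to it a trivial fibration. -/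
theorem exists_twisted_lift {S : SSet.{max u v}} (s : S ⟶ nerve D) :
    ∃ a : S ⟶ twisted (Y ⋙ TopCat.toSSet), a ≫ twisted.proj _ = s := by
  let T : SSet.{max u v} := (Functor.const _).obj PUnit
  let α : Y ⋙ TopCat.toSSet ⟶ (Functor.const D).obj T :=
    { app d := { app n := ↾fun _ ↦ PUnit.unit } }
  have : ∀ n, Subsingleton (T.obj n) := fun n ↦ inferInstanceAs (Subsingleton PUnit)
  have hα : I.rlp (twisted.map α) := twisted.rlp_I_map α fun d ↦
    have := hY d
    rlp_I_toSSet_of_contractible (Y := Y.obj d) (T := T) (α.app d)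
  let s' : S ⟶ twisted ((Functor.const D).obj T) :=
    { app n := ↾fun x ↦ ⟨s.app n x, PUnit.unit⟩
      naturality n m θ := ConcreteCategory.hom_ext _ _ fun x ↦ by
        have h := ConcreteCategory.congr_hom (s.naturality θ) x
        exact congr_arg (fun τ : (nerve D).obj m ↦
          (⟨τ, PUnit.unit⟩ : (twisted ((Functor.const D).obj T)).obj m)) h }
  obtain ⟨a, ha⟩ := exists_lift_of_rlp_I hα s'
  exact ⟨a, congr_arg (· ≫ twisted.proj _) ha⟩

/-- The pair `(a, b)` lifts to the total object of the fibrewise path spaces, and the cocone `k`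
carries these paths into `B`. This is the uniqueness behind both homotopies in Theorem A. -/
theorem homotopic_of_twisted_lifts {S : SSet.{max u v}} (a b : S ⟶ twisted (Y ⋙ TopCat.toSSet))
    (hab : a ≫ twisted.proj _ = b ≫ twisted.proj _) {B : TopCat.{max u v}}
    (k : Y ⟶ (Functor.const D).obj B) (f g : SSet.toTop.obj S ⟶ B)
    (hf : sSetTopAdj.homEquiv S B f = a ≫ twisted.desc (singularCocone k))
    (hg : sSetTopAdj.homEquiv S B g = b ≫ twisted.desc (singularCocone k)) :
    f.hom.Homotopic g.hom := by
  obtain ⟨p, hp₁, hp₂⟩ := exists_twisted_pair a b hab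
  have hrlp : I.rlp (twisted.map (Functor.whiskerRight (pathSpaceFunctorEnds Y) TopCat.toSSet)) :=
    twisted.rlp_I_map _ fun d ↦
      have := hY d
      rlp_I_toSSet_pathSpaceEnds (Y := Y.obj d)
  obtain ⟨c, hc⟩ := exists_lift_of_rlp_I hrlp p
  let kp : pathSpaceFunctor Y ⟶ (Functor.const D).obj (pathSpace B) :=
    { app d := TopCat.ofHom ⟨fun γ ↦ (k.app d).hom.comp γ, by fun_prop⟩
      naturality d d' f := by
        refine ConcreteCategory.hom_ext _ _ fun γ ↦
          @ContinuousMap.ext unitInterval B _ _ _ _ fun t ↦ ?_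
        exact ConcreteCategory.congr_hom (k.naturality f)
          (DFunLike.coe (F := C(unitInterval, Y.obj d)) γ t) }
  let π₁ : TopCat.of (B × B) ⟶ B := TopCat.ofHom ⟨Prod.fst, continuous_fst⟩
  let π₂ : TopCat.of (B × B) ⟶ B := TopCat.ofHom ⟨Prod.snd, continuous_snd⟩
  refine homotopic_of_lift_pathSpace f g (c ≫ twisted.desc (singularCocone kp)) ?_
  have key : ∀ {s t : S ⟶ TopCat.toSSet.obj (TopCat.of (B × B))},
      s ≫ TopCat.toSSet.map π₁ = t ≫ TopCat.toSSet.map π₁ →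
      s ≫ TopCat.toSSet.map π₂ = t ≫ TopCat.toSSet.map π₂ → s = t := by
    intro s t h₁ h₂
    refine toSSet_ext fun m x ↦ ContinuousMap.ext fun q ↦ Prod.ext ?_ ?_
    · exact congr_arg (fun z ↦ B.toSSetObjEquiv _ z q)
        (ConcreteCategory.congr_hom (NatTrans.congr_app h₁ (op ⦋m⦌)) x)
    · exact congr_arg (fun z ↦ B.toSSetObjEquiv _ z q)
        (ConcreteCategory.congr_hom (NatTrans.congr_app h₂ (op ⦋m⦌)) x)
  refine key ?_ ?_
  · rw [← sSetTopAdj.homEquiv_naturality_right]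
    refine Eq.trans ?_ hf.symm
    rw [← hp₁, ← hc]
    rfl
  · rw [← sSetTopAdj.homEquiv_naturality_right]
    refine Eq.trans ?_ hg.symm
    rw [← hp₂, ← hc]
    rfl

end Lifts

/-! ### Filtered colimits of contractible simplicial sets -/

section Contractible

open Opposite Simplicial SSet.modelCategoryQuillen Limits

universe w

/-- `∂Δ[n]` and `Δ[n]` are finitely presentable, so a lifting problem already lives at some stage of
the colimit. -/
theorem rlp_I_colimMap {J : Type w} [SmallCategory J] [IsFiltered J] {P Q : J ⥤ SSet.{w}}
    (α : P ⟶ Q) (hα : ∀ j, I.rlp (α.app j)) : I.rlp (colimMap α) := by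
  rintro _ _ _ ⟨n⟩
  refine ⟨fun {t b} sq ↦ ?_⟩
  obtain ⟨j, t', ht⟩ := IsFinitelyPresentable.exists_hom_of_isColimit (colimit.isColimit P) t
  obtain ⟨k, b', hb⟩ := IsFinitelyPresentable.exists_hom_of_isColimit (colimit.isColimit Q) b
  have hw := sq.w
  rw [← ht, ← hb] at hw
  -- The two halves of the square are only known to agree in the colimit; they do agree at a later
  -- stage `l`.
  obtain ⟨l, f, g, h⟩ := IsFinitelyPresentable.exists_eq_of_isColimit (colimit.isColimit Q)
    (t' ≫ α.app j) ((∂Δ[n] : SSet.Subcomplex _).ι ≫ b') (by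
      refine Eq.trans ?_ hw
      simp)
  have sq' : CommSq (t' ≫ P.map f) (∂Δ[n] : SSet.Subcomplex _).ι (α.app l) (b' ≫ Q.map g) :=
    ⟨by simpa using h⟩
  have : HasLiftingProperty (∂Δ[n] : SSet.Subcomplex.{w} _).ι (α.app l) :=
    hα l _ (boundary_ι_mem_I n)
  refine ⟨⟨⟨sq'.lift ≫ colimit.ι P l, ?_, ?_⟩⟩⟩
  · rw [sq'.fac_left_assoc, ← ht]
    simp
  · rw [Category.assoc, ι_colimMap, sq'.fac_right_assoc, ← hb]
    simp

/-- The point of the geometric realization given by a vertex. -/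
def vertexPoint {X : SSet.{w}} (x : X _⦋0⦌) : SSet.toTop.obj X :=
  SSet.toTop.map (SSet.yonedaEquiv.symm x) default

theorem toTop_map_vertexPoint {X X' : SSet.{w}} (f : X ⟶ X') (x : X _⦋0⦌) :
    SSet.toTop.map f (vertexPoint x) = vertexPoint (f.app _ x) := by
  have h : SSet.yonedaEquiv.symm x ≫ f = SSet.yonedaEquiv.symm (f.app _ x) := by
    apply SSet.yonedaEquiv.injective
    rw [SSet.yonedaEquiv_comp, Equiv.apply_symm_apply, Equiv.apply_symm_apply]
  have h' := ConcreteCategory.congr_hom (congr_arg SSet.toTop.map h) default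
  rw [SSet.toTop.map_comp] at h'
  exact h'

/-- The singular version of `y ↦ (y, x)`, for a vertex `x`. -/
def basedDiagonal {X : SSet.{w}} (x : X _⦋0⦌) :
    X ⟶ TopCat.toSSet.obj (TopCat.of (SSet.toTop.obj X × SSet.toTop.obj X)) :=
  sSetTopAdj.homEquiv X _
    (TopCat.ofHom ((ContinuousMap.id _).prodMk (ContinuousMap.const _ (vertexPoint x))))

theorem basedDiagonal_naturality {X X' : SSet.{w}} (f : X ⟶ X') (x : X _⦋0⦌) :
    basedDiagonal x ≫ TopCat.toSSet.map
      (TopCat.ofHom ((SSet.toTop.map f).hom.prodMap (SSet.toTop.map f).hom)) =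
    f ≫ basedDiagonal (f.app _ x) := by
  unfold basedDiagonal
  rw [← sSetTopAdj.homEquiv_naturality_right, ← sSetTopAdj.homEquiv_naturality_left]
  congr 1
  refine ConcreteCategory.hom_ext _ _ fun y ↦ ?_
  exact @Prod.ext (SSet.toTop.obj X') (SSet.toTop.obj X') (_, _) (_, _) rfl
    (toTop_map_vertexPoint f x)

/-- A filtered colimit of simplicial sets with contractible realizations, with a compatible choice
of base points, has a contractible realization. -/
theorem contractibleSpace_of_isColimit {J : Type w} [SmallCategory J] [IsFiltered J]
    {F : J ⥤ SSet.{w}} {c : Cocone F} (hcol : IsColimit c) (v : ∀ j, (F.obj j) _⦋0⦌)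
    (hv : ∀ {i j : J} (f : i ⟶ j), (F.map f).app _ (v i) = v j)
    (x : c.pt _⦋0⦌) (hx : ∀ j, (c.ι.app j).app _ (v j) = x)
    (hc : ∀ j, ContractibleSpace (SSet.toTop.obj (F.obj j))) :
    ContractibleSpace (SSet.toTop.obj c.pt) := by
  let Y : J ⥤ TopCat.{w} := F ⋙ SSet.toTop
  let P := pathSpaceFunctor Y ⋙ TopCat.toSSet
  let Q := squareFunctor Y ⋙ TopCat.toSSet
  let α : P ⟶ Q := Functor.whiskerRight (pathSpaceFunctorEnds Y) _
  have hα : I.rlp (colimMap α) := rlp_I_colimMap α fun j ↦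
    have : ContractibleSpace (Y.obj j) := hc j
    rlp_I_toSSet_pathSpaceEnds (Y := Y.obj j)
  let Z := SSet.toTop.obj c.pt
  let q' : F ⟶ Q :=
    { app j := basedDiagonal (v j)
      naturality i j f := by
        rw [← hv f]
        exact (basedDiagonal_naturality (F.map f) _).symm }
  let q : c.pt ⟶ colimit Q := hcol.desc ((Cocone.precompose q').obj (colimit.cocone Q))
  -- Contractions of the separate stages need not be compatible. The lift chooses paths in the
  -- colimit instead, and these map to paths in `Z` from each point to the base point.
  obtain ⟨l, hl⟩ := exists_lift_of_rlp_I hα q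
  let ρ : ∀ j, Y.obj j ⟶ Z := fun j ↦ SSet.toTop.map (c.ι.app j)
  have hρ : ∀ {i j : J} (f : i ⟶ j), Y.map f ≫ ρ j = ρ i := fun {i j} f ↦
    (SSet.toTop.map_comp _ _).symm.trans (congr_arg _ (c.w f))
  let kp : P ⟶ (Functor.const J).obj (TopCat.toSSet.obj (pathSpace Z)) :=
    { app j := TopCat.toSSet.map (TopCat.ofHom ⟨fun γ ↦ (ρ j).hom.comp γ, by fun_prop⟩)
      naturality i j f := by
        refine (TopCat.toSSet.map_comp _ _).symm.trans ?_
        refine Eq.trans ?_ (Category.comp_id _).symm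
        congr 1
        refine ConcreteCategory.hom_ext _ _ fun γ ↦
          @ContinuousMap.ext unitInterval Z _ _ _ _ fun t ↦ ?_
        exact ConcreteCategory.congr_hom (hρ f)
          (DFunLike.coe (F := C(unitInterval, Y.obj i)) γ t) }
  let kq : Q ⟶ (Functor.const J).obj (TopCat.toSSet.obj (TopCat.of (Z × Z))) :=
    { app j := TopCat.toSSet.map (TopCat.ofHom ((ρ j).hom.prodMap (ρ j).hom))
      naturality i j f := by
        refine (TopCat.toSSet.map_comp _ _).symm.trans ?_
        refine Eq.trans ?_ (Category.comp_id _).symm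
        congr 1
        refine ConcreteCategory.hom_ext _ _ fun y ↦ ?_
        exact @Prod.ext Z Z (_, _) (_, _) (ConcreteCategory.congr_hom (hρ f) y.1)
          (ConcreteCategory.congr_hom (hρ f) y.2) }
  let γ : c.pt ⟶ TopCat.toSSet.obj (pathSpace Z) := l ≫ colimit.desc P ⟨_, kp⟩
  have hγ : γ ≫ TopCat.toSSet.map (pathSpaceEnds Z) = basedDiagonal x := by
    have h1 : colimit.desc P ⟨_, kp⟩ ≫ TopCat.toSSet.map (pathSpaceEnds Z) =
        colimMap α ≫ colimit.desc Q ⟨_, kq⟩ := by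
      refine colimit.hom_ext fun j ↦ ?_
      rw [colimit.ι_desc_assoc, ι_colimMap_assoc, colimit.ι_desc]
      rfl
    have h2 : q ≫ colimit.desc Q ⟨_, kq⟩ = basedDiagonal x := by
      refine hcol.hom_ext fun j ↦ ?_
      rw [hcol.fac_assoc]
      change (q'.app j ≫ colimit.ι Q j) ≫ _ = _
      rw [Category.assoc, colimit.ι_desc, ← hx j]
      exact basedDiagonal_naturality (c.ι.app j) _
    rw [Category.assoc, h1, ← Category.assoc, hl, h2]
  rw [contractible_iff_id_nullhomotopic]
  exact ⟨vertexPoint x, homotopic_of_lift_pathSpace (𝟙 Z)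
    (TopCat.ofHom (ContinuousMap.const _ (vertexPoint x))) γ hγ⟩

theorem contractibleSpace_of_directed {S : SSet.{w}} {J : Type w} [Preorder J] [IsDirectedOrder J]
    [Nonempty J] (A : J →o S.Subcomplex) (hA : ∀ {n} (x : S.obj n), ∃ j, x ∈ (A j).obj n)
    (v : S _⦋0⦌) (hv : ∀ j, v ∈ (A j).obj _)
    (hc : ∀ j, ContractibleSpace (SSet.toTop.obj (A j : SSet.{w}))) :
    ContractibleSpace (SSet.toTop.obj S) := by
  let F : J ⥤ SSet.{w} := A.monotone.functor ⋙ SSet.Subcomplex.toSSetFunctor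
  let c : Cocone F := { pt := S, ι := { app j := (A j).ι } }
  have hcol : IsColimit c := evaluationJointlyReflectsColimits _ fun n ↦
    Types.FilteredColimit.isColimitOf' _ _
      (fun x ↦ by
        obtain ⟨j, hj⟩ := hA x
        exact ⟨j, ⟨x, hj⟩, rfl⟩)
      (fun j x y h ↦ ⟨j, 𝟙 j, by
        obtain rfl : x = y := Subtype.ext h
        rfl⟩)
  exact contractibleSpace_of_isColimit hcol (fun j ↦ ⟨v, hv j⟩) (fun f ↦ rfl) v (fun j ↦ rfl) hc

end Contractible

/-! ### Contracting a simplicial set along a cone structure -/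

section Cone

open Opposite Simplicial

universe w

/-- The cone `⦋m + 1⦌ ⟶ ⦋n + 1⦌` on a simplicial operator, preserving the vertex `0`. -/
def coneHom {m n : SimplexCategory} (θ : m ⟶ n) : ⦋m.len + 1⦌ ⟶ ⦋n.len + 1⦌ :=
  SimplexCategory.Hom.mk ⟨Fin.cases 0 fun i ↦ (θ.toOrderHom i).succ, fun i j hij ↦ by
    induction i using Fin.cases with
    | zero => exact Fin.zero_le _
    | succ i =>
      induction j using Fin.cases with
      | zero => exact absurd hij (by simp)
      | succ j => exact Fin.succ_le_succ_iff.2 (θ.toOrderHom.monotone (Fin.succ_le_succ_iff.1 hij))⟩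

/-- The inclusion of the base of the cone. -/
def coneBase (n : SimplexCategory) : n ⟶ ⦋n.len + 1⦌ :=
  SimplexCategory.Hom.mk ⟨Fin.succ, Fin.strictMono_succ.monotone⟩

/-- The inclusion of the apex of the cone. -/
def coneApex (n : SimplexCategory) : ⦋0⦌ ⟶ ⦋n.len + 1⦌ :=
  SimplexCategory.Hom.mk ⟨fun _ ↦ 0, fun _ _ _ ↦ le_rfl⟩

/-- The straight line homotopy from the base of the cone to its apex. -/
def coneMap (n : ℕ) : C(stdSimplex ℝ (Fin (n + 1)) × unitInterval, stdSimplex ℝ (Fin (n + 2))) where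
  toFun x := ⟨Fin.cons (x.2 : ℝ) fun i ↦ (1 - x.2 : ℝ) * x.1 i, by
    refine ⟨fun i ↦ ?_, ?_⟩
    · induction i using Fin.cases with
      | zero => exact x.2.2.1
      | succ i => exact mul_nonneg (sub_nonneg.2 x.2.2.2) (stdSimplex.zero_le _ _)
    · rw [Fin.sum_univ_succ]
      simp only [Fin.cons_zero, Fin.cons_succ, ← Finset.mul_sum, stdSimplex.sum_eq_one]
      ring⟩
  continuous_toFun := by
    refine Continuous.subtype_mk (continuous_pi fun i ↦ ?_) _
    induction i using Fin.cases with
    | zero => exact continuous_subtype_val.comp continuous_snd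
    | succ i =>
      have h : Continuous fun x : (stdSimplex ℝ (Fin (n + 1))) × unitInterval ↦ x.1 i :=
        (continuous_apply i).comp (continuous_subtype_val.comp continuous_fst)
      simp only [Fin.cons_succ]
      exact Continuous.mul (by fun_prop) h

theorem stdSimplex_map_apply {α β : Type*} [Fintype α] [Fintype β] [DecidableEq β] (f : α → β)
    (p : stdSimplex ℝ α) (j : β) : stdSimplex.map f p j = ∑ i, if f i = j then p i else 0 := by
  rw [stdSimplex.map_coe, FunOnFinite.linearMap_apply_apply, Finset.sum_filter]

theorem coneMap_zero (n : SimplexCategory) (p : stdSimplex ℝ (Fin (n.len + 1))) :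
    coneMap n.len (p, 0) = stdSimplex.map (coneBase n).toOrderHom p := by
  apply stdSimplex.ext
  funext j
  rw [stdSimplex_map_apply]
  induction j using Fin.cases with
  | zero =>
    refine Eq.trans ?_ (Finset.sum_eq_zero fun i _ ↦ if_neg (Fin.succ_ne_zero i)).symm
    rfl
  | succ j =>
    change (1 - 0 : ℝ) * p j = ∑ i : Fin (n.len + 1), if i.succ = j.succ then p i else 0
    simp

theorem coneMap_one (n : SimplexCategory) (p : stdSimplex ℝ (Fin (n.len + 1)))
    (q : stdSimplex ℝ (Fin 1)) :
    coneMap n.len (p, 1) = stdSimplex.map (coneApex n).toOrderHom q := by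
  apply stdSimplex.ext
  funext j
  rw [stdSimplex_map_apply]
  induction j using Fin.cases with
  | zero =>
    change (1 : ℝ) = ∑ i : Fin 1, if (0 : Fin (n.len + 2)) = 0 then q i else 0
    simp
  | succ j =>
    change (1 - 1 : ℝ) * p j = ∑ i : Fin 1, if (0 : Fin (n.len + 2)) = j.succ then q i else 0
    simp [(Fin.succ_ne_zero j).symm]

theorem coneMap_naturality {m n : SimplexCategory} (θ : m ⟶ n)
    (p : stdSimplex ℝ (Fin (m.len + 1))) (t : unitInterval) :
    stdSimplex.map (coneHom θ).toOrderHom (coneMap m.len (p, t)) =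
      coneMap n.len (stdSimplex.map θ.toOrderHom p, t) := by
  apply stdSimplex.ext
  funext j
  rw [stdSimplex_map_apply, Fin.sum_univ_succ]
  induction j using Fin.cases with
  | zero =>
    refine (congr_arg₂ (· + ·) (if_pos rfl)
      (Finset.sum_eq_zero fun i _ ↦ if_neg (Fin.succ_ne_zero _))).trans ?_
    exact add_zero _
  | succ j =>
    refine (congr_arg₂ (· + ·) (if_neg (Fin.succ_ne_zero _).symm) rfl).trans ?_
    rw [zero_add]
    change (∑ i : Fin (m.len + 1), if (θ.toOrderHom i).succ = j.succ then (1 - t : ℝ) * p i else 0) =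
      (1 - t : ℝ) * stdSimplex.map θ.toOrderHom p j
    rw [stdSimplex_map_apply, Finset.mul_sum]
    refine Finset.sum_congr rfl fun i _ ↦ ?_
    simp [mul_ite]

theorem toSSetObjEquiv_homEquiv {X : SSet.{w}} {Z : TopCat.{w}} (f : SSet.toTop.obj X ⟶ Z)
    {n : SimplexCategoryᵒᵖ} (x : X.obj n) (p : stdSimplex ℝ (Fin (n.unop.len + 1))) :
    Z.toSSetObjEquiv n ((sSetTopAdj.homEquiv X Z f).app n x) p =
      f ((SSet.toTop.obj X).toSSetObjEquiv n ((sSetTopAdj.unit.app X).app n x) p) := by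
  rw [sSetTopAdj.homEquiv_unit]
  rfl

theorem toSSetObjEquiv_unit_vertex {X : SSet.{w}} (x : X _⦋0⦌) (p : stdSimplex ℝ (Fin 1)) :
    (SSet.toTop.obj X).toSSetObjEquiv (op ⦋0⦌) ((sSetTopAdj.unit.app X).app _ x) p =
      vertexPoint x := by
  have h := sSetTopAdj_unit_app_app_down X (op ⦋0⦌) x
  refine (ConcreteCategory.congr_hom h (ULift.up p)).trans ?_
  exact congr_arg (SSet.toTop.map (SSet.yonedaEquiv.symm x)) (Subsingleton.elim _ _)

/-- The family of maps from the topological simplices to `Z` given by a map to the singular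
simplicial set of `Z`. -/
def simplexMap {S : SSet.{w}} {Z : TopCat.{w}} (η : S ⟶ TopCat.toSSet.obj Z) (n : SimplexCategory)
    (σ : S.obj (op n)) : C(stdSimplex ℝ (Fin (n.len + 1)), Z) :=
  Z.toSSetObjEquiv (op n) (η.app (op n) σ)

theorem simplexMap_map {S : SSet.{w}} {Z : TopCat.{w}} (η : S ⟶ TopCat.toSSet.obj Z)
    {m n : SimplexCategory} (θ : m ⟶ n) (σ : S.obj (op n))
    (p : stdSimplex ℝ (Fin (m.len + 1))) :
    simplexMap η m (S.map θ.op σ) p = simplexMap η n σ (stdSimplex.map θ.toOrderHom p) := by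
  have h : η.app (op m) (S.map θ.op σ) = (TopCat.toSSet.obj Z).map θ.op (η.app (op n) σ) :=
    ConcreteCategory.congr_hom (η.naturality θ.op) σ
  unfold simplexMap
  rw [h]
  generalize η.app (op n) σ = y
  rfl

section

variable {S : SSet.{w}} (c : ∀ n : SimplexCategory, S.obj (op n) → S.obj (op ⦋n.len + 1⦌))
  (hnat : ∀ {m n : SimplexCategory} (θ : m ⟶ n) (σ : S.obj (op n)),
    S.map (coneHom θ).op (c n σ) = c m (S.map θ.op σ))

/-- The path of singular simplices obtained by contracting the cone over each simplex. -/
def coneContraction {Z : TopCat.{w}} (η : S ⟶ TopCat.toSSet.obj Z) :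
    S ⟶ TopCat.toSSet.obj (pathSpace Z) where
  app n := ↾fun σ ↦ ((pathSpace Z).toSSetObjEquiv n).symm
    ((simplexMap η _ (c n.unop σ)).comp (coneMap n.unop.len)).curry
  naturality n m θ := by
    refine ConcreteCategory.hom_ext _ _ fun σ ↦ ?_
    apply ((pathSpace Z).toSSetObjEquiv _).injective
    refine ContinuousMap.ext fun p ↦ @ContinuousMap.ext unitInterval Z _ _ _ _ fun t ↦ ?_
    have h1 := simplexMap_map η (coneHom θ.unop) (c n.unop σ) (coneMap _ (p, t))
    rw [hnat, coneMap_naturality] at h1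
    exact h1

end

/-- A simplicial set which is a retract of the cone over it in a compatible way has a contractible
realization. -/
theorem contractibleSpace_of_cone {S : SSet.{w}}
    (c : ∀ n : SimplexCategory, S.obj (op n) → S.obj (op ⦋n.len + 1⦌))
    (hnat : ∀ {m n : SimplexCategory} (θ : m ⟶ n) (σ : S.obj (op n)),
      S.map (coneHom θ).op (c n σ) = c m (S.map θ.op σ))
    (hbase : ∀ (n : SimplexCategory) (σ : S.obj (op n)), S.map (coneBase n).op (c n σ) = σ)
    (v : S _⦋0⦌)
    (hv : ∀ (n : SimplexCategory) (σ : S.obj (op n)), S.map (coneApex n).op (c n σ) = v) :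
    ContractibleSpace (SSet.toTop.obj S) := by
  -- At time `0` the path through the cone over `σ` is at its base, which is `σ`; at time `1` it is
  -- at the apex `v`.
  have key : ∀ (Z : TopCat.{w}) (η : S ⟶ TopCat.toSSet.obj Z) (z : Z)
      (_ : ∀ p, simplexMap η ⦋0⦌ v p = z) (d : S ⟶ TopCat.toSSet.obj (TopCat.of (Z × Z)))
      (_ : ∀ (m : ℕ) (σ : S _⦋m⦌) p,
        simplexMap d ⦋m⦌ σ p = (simplexMap η ⦋m⦌ σ p, z)),
      coneContraction c hnat η ≫ TopCat.toSSet.map (pathSpaceEnds Z) = d := by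
    intro Z η z hz d hd
    refine toSSet_ext fun m σ ↦ ContinuousMap.ext fun p ↦ ?_
    refine Eq.trans ?_ (hd m σ p).symm
    have h0 := simplexMap_map η (coneBase ⦋m⦌) (c ⦋m⦌ σ) p
    rw [hbase, ← coneMap_zero] at h0
    have h1 := simplexMap_map η (coneApex ⦋m⦌) (c ⦋m⦌ σ) default
    rw [hv, ← coneMap_one ⦋m⦌ p default, hz] at h1
    exact @Prod.ext Z Z (_, _) (_, _) h0.symm h1.symm
  rw [contractible_iff_id_nullhomotopic]
  refine ⟨vertexPoint v, homotopic_of_lift_pathSpace (𝟙 (SSet.toTop.obj S))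
    (TopCat.ofHom (ContinuousMap.const _ (vertexPoint v)))
    (coneContraction c hnat (sSetTopAdj.unit.app S)) ?_⟩
  refine key _ _ (vertexPoint v) (fun p ↦ toSSetObjEquiv_unit_vertex v p) _ fun m σ p ↦ ?_
  exact toSSetObjEquiv_homEquiv _ _ _

end Cone

/-! ### Thin categories with common lower bounds -/

section Thin

open Opposite Simplicial

variable {U : Type u} [Category.{v} U]

/-- The simplices of the nerve whose initial vertex receives an arrow from `z`. -/
def nerveAbove (z : U) : (nerve U).Subcomplex where
  obj n := {σ | Nonempty (z ⟶ ComposableArrows.left (n := n.unop.len) σ)}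
  map {n m} θ σ hσ := hσ.map fun f ↦
    f ≫ ComposableArrows.map' (n := n.unop.len) σ 0 (θ.unop.toOrderHom 0)

theorem nerveAbove_mono {z z' : U} (f : z' ⟶ z) : nerveAbove z ≤ nerveAbove z' :=
  fun _ _ hσ ↦ hσ.map fun g ↦ f ≫ g

/-- Prepending `z` to a chain is the cone structure. The arrow from `z` is chosen, but thinness
makes simplices depend only on their vertices, so all compatibilities hold. -/
theorem contractibleSpace_nerveAbove [Quiver.IsThin U] (z : U) :
    ContractibleSpace (SSet.toTop.obj (nerveAbove z : SSet)) := by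
  refine contractibleSpace_of_cone (S := nerveAbove z)
    (fun n σ ↦ ⟨ComposableArrows.precomp (n := n.len) σ.1 σ.2.some, ⟨𝟙 z⟩⟩) ?_ ?_
    ⟨ComposableArrows.mk₀ z, ⟨𝟙 z⟩⟩ ?_
  · intro m n θ σ
    refine Subtype.ext (nerve.ext_of_isThin (funext fun i ↦ ?_))
    induction i using Fin.cases with
    | zero => rfl
    | succ i => rfl
  · intro n σ
    exact Subtype.ext (nerve.ext_of_isThin (funext fun i ↦ rfl))
  · intro n σ
    exact Subtype.ext (nerve.ext_of_isThin (funext fun i ↦ rfl))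

/-- The realization of the nerve of a nonempty thin category in which any two objects have a common
lower bound is contractible. -/
theorem contractibleSpace_nerve_of_isThin [Quiver.IsThin U] [Nonempty U]
    (h : ∀ x y : U, ∃ z, Nonempty (z ⟶ x) ∧ Nonempty (z ⟶ y)) :
    ContractibleSpace (SSet.toTop.obj (nerve U)) := by
  obtain ⟨x₀⟩ := ‹Nonempty U›
  -- Restricting to objects below `x₀` keeps the vertex `x₀` in every piece, as a common base point.
  -- The order is reversed because a lower `z` gives a larger subcomplex.
  let J := ULift.{v} {z : U // Nonempty (z ⟶ x₀)}
  let _ : Preorder J :=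
    { le z z' := Nonempty (z'.down.1 ⟶ z.down.1)
      le_refl z := ⟨𝟙 _⟩
      le_trans _ _ _ := fun ⟨f⟩ ⟨g⟩ ↦ ⟨g ≫ f⟩ }
  have : IsDirectedOrder J := ⟨fun x y ↦ by
    obtain ⟨z, ⟨f⟩, ⟨g⟩⟩ := h x.down.1 y.down.1
    exact ⟨⟨z, ⟨f ≫ x.down.2.some⟩⟩, ⟨f⟩, ⟨g⟩⟩⟩
  have : Nonempty J := ⟨⟨x₀, ⟨𝟙 _⟩⟩⟩
  refine contractibleSpace_of_directed (J := J)
    ⟨fun z ↦ nerveAbove z.down.1, fun z z' f ↦ nerveAbove_mono (Nonempty.some f)⟩ (fun {n} σ ↦ ?_)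
    (ComposableArrows.mk₀ x₀) (fun z ↦ z.down.2) (fun z ↦ contractibleSpace_nerveAbove z.down.1)
  obtain ⟨z, ⟨f⟩, hz⟩ := h x₀ (ComposableArrows.left (n := n.unop.len) σ)
  exact ⟨⟨z, ⟨f⟩⟩, hz⟩

end Thin

/-! ### The local system of fibres of a map to the nerve of a groupoid -/

section Cover

open Opposite Simplicial

variable {D : Type u} [Groupoid.{max u v} D]

/-- The local system of discrete simplicial sets `x ↦ (d ⟶ x)`. -/
def homLocalSystem (d : D) : D ⥤ SSet.{max u v} where
  obj x := (Functor.const _).obj (d ⟶ x)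
  map f := { app _ := ↾fun a ↦ a ≫ f }
  map_id x := by ext n a; exact Category.comp_id a
  map_comp f g := by ext n a; exact (Category.assoc a f g).symm

/-- The local systems `homLocalSystem d` depend functorially on `d`. -/
def homLocalSystemMap {d d' : D} (f : d ⟶ d') : homLocalSystem d ⟶ homLocalSystem d' where
  app x := { app _ := ↾fun a ↦ Groupoid.inv f ≫ a }
  naturality x y g := by ext n a; exact (Category.assoc (Groupoid.inv f) a g).symm

/-- The simplicial set of simplices `σ` of `S` with an arrow from `d` to the initial vertex of the
image of `σ`. -/
def coverFibre {S : SSet.{max u v}} (s : S ⟶ nerve D) (d : D) : SSet.{max u v} where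
  obj n := {p : S.obj n × (twisted (homLocalSystem d)).obj n // s.app n p.1 = p.2.1}
  map θ := ↾fun p ↦ ⟨(S.map θ p.1.1, (twisted (homLocalSystem d)).map θ p.1.2),
    (ConcreteCategory.congr_hom (s.naturality θ) p.1.1).trans (congr_arg ((nerve D).map θ) p.2)⟩
  map_id n := ConcreteCategory.hom_ext _ _ fun p ↦ Subtype.ext (Prod.ext
    (ConcreteCategory.congr_hom (S.map_id n) p.1.1)
    (ConcreteCategory.congr_hom ((twisted (homLocalSystem d)).map_id n) p.1.2))
  map_comp f g := ConcreteCategory.hom_ext _ _ fun p ↦ Subtype.ext (Prod.ext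
    (ConcreteCategory.congr_hom (S.map_comp f g) p.1.1)
    (ConcreteCategory.congr_hom ((twisted (homLocalSystem d)).map_comp f g) p.1.2))

theorem coverFibre_ext {S : SSet.{max u v}} {s : S ⟶ nerve D} {d : D} {n : SimplexCategoryᵒᵖ}
    {p q : (coverFibre s d).obj n} (h₁ : p.1.1 = q.1.1) (h₂ : p.1.2 = q.1.2) : p = q :=
  Subtype.ext (Prod.ext h₁ h₂)

/-- Transport along an arrow of `D`. -/
def coverFibreMap {S : SSet.{max u v}} (s : S ⟶ nerve D) {d d' : D} (f : d ⟶ d') :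
    coverFibre s d ⟶ coverFibre s d' where
  app n := ↾fun p ↦ ⟨(p.1.1, (twisted.map (homLocalSystemMap f)).app n p.1.2), p.2⟩
  naturality n m θ := by
    refine ConcreteCategory.hom_ext _ _ fun p ↦ coverFibre_ext ?_ ?_
    · rfl
    · exact ConcreteCategory.congr_hom ((twisted.map (homLocalSystemMap f)).naturality θ) p.1.2

/-- The projection to `S`. -/
def coverFibreProj {S : SSet.{max u v}} (s : S ⟶ nerve D) (d : D) : coverFibre s d ⟶ S where
  app n := ↾fun p ↦ p.1.1

/-- The functoriality of the fibres. -/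
def coverFibreDesc {S S' : SSet.{max u v}} {s : S ⟶ nerve D} (t : S ⟶ S') (s' : S' ⟶ nerve D)
    (h : t ≫ s' = s) (d : D) : coverFibre s d ⟶ coverFibre s' d where
  app n := ↾fun p ↦ ⟨(t.app n p.1.1, p.1.2),
    (ConcreteCategory.congr_hom (NatTrans.congr_app h n) p.1.1).trans p.2⟩
  naturality n m θ := by
    refine ConcreteCategory.hom_ext _ _ fun p ↦ coverFibre_ext ?_ ?_
    · exact ConcreteCategory.congr_hom (t.naturality θ) p.1.1
    · rfl

/-- The local system on `D` whose total simplicial set resolves `S`. -/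
def cover {S : SSet.{max u v}} (s : S ⟶ nerve D) : D ⥤ SSet.{max u v} where
  obj d := coverFibre s d
  map f := coverFibreMap s f
  map_id d := by
    refine NatTrans.ext (funext fun n ↦ ConcreteCategory.hom_ext _ _ fun p ↦ coverFibre_ext ?_ ?_)
    · rfl
    refine congr_arg (Sigma.mk (p : (coverFibre s d).obj n).1.2.1) ?_
    let a : d ⟶ ComposableArrows.left (n := n.unop.len) (p : (coverFibre s d).obj n).1.2.1 :=
      (p : (coverFibre s d).obj n).1.2.2
    change Groupoid.inv (𝟙 d) ≫ a = a
    simp [Groupoid.inv_eq_inv]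
  map_comp {d d' d''} f g := by
    refine NatTrans.ext (funext fun n ↦ ConcreteCategory.hom_ext _ _ fun p ↦ coverFibre_ext ?_ ?_)
    · rfl
    refine congr_arg (Sigma.mk (p : (coverFibre s d).obj n).1.2.1) ?_
    let a : d ⟶ ComposableArrows.left (n := n.unop.len) (p : (coverFibre s d).obj n).1.2.1 :=
      (p : (coverFibre s d).obj n).1.2.2
    change Groupoid.inv (f ≫ g) ≫ a = Groupoid.inv g ≫ Groupoid.inv f ≫ a
    simp [Groupoid.inv_eq_inv]

variable {S S' : SSet.{max u v}}

/-- The projection to `S`. -/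
def coverProj (s : S ⟶ nerve D) : cover s ⟶ (Functor.const D).obj S where
  app d := coverFibreProj s d

/-- The functoriality of the cover. -/
def coverDesc {s : S ⟶ nerve D} (t : S ⟶ S') (s' : S' ⟶ nerve D) (h : t ≫ s' = s) :
    cover s ⟶ cover s' where
  app d := coverFibreDesc t s' h d

/-- A simplex of the total simplicial set of the cover. -/
def coverSimplex (s : S ⟶ nerve D) {n : SimplexCategoryᵒᵖ} (σ : S.obj n) (τ : (nerve D).obj n)
    (h : s.app n σ = τ) : (twisted (cover s)).obj n :=
  ⟨τ, (⟨(σ, ⟨τ, 𝟙 (τ.obj 0)⟩), h⟩ : (coverFibre s (τ.obj 0)).obj n)⟩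

/-- The canonical section of the projection from the total simplicial set of the cover. -/
def coverSection (s : S ⟶ nerve D) : S ⟶ twisted (cover s) where
  app n := ↾fun σ ↦ coverSimplex s σ _ rfl
  naturality n m θ := ConcreteCategory.hom_ext _ _ fun σ ↦ by
    have h := ConcreteCategory.congr_hom (s.naturality θ) σ
    have h' : ∀ τ (hτ : s.app m (S.map θ σ) = τ),
        coverSimplex s (S.map θ σ) _ rfl = coverSimplex s (S.map θ σ) τ hτ := by
      rintro _ rfl
      rfl
    refine (h' _ h).trans ?_
    refine congr_arg (Sigma.mk _) (coverFibre_ext rfl (congr_arg (Sigma.mk _) ?_))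
    -- Transport changes the fibre index and the marking arrow together, so the identity marking is
    -- conjugated to the identity marking of the new initial vertex.
    let τ := s.app n σ
    change 𝟙 (((nerve D).map θ τ).obj 0) =
      Groupoid.inv (firstArrow θ τ) ≫ 𝟙 (τ.obj 0) ≫ firstArrow θ τ
    simp [Groupoid.inv_eq_inv]

/-- The fibrewise realization of the cover. -/
abbrev coverSpace (s : S ⟶ nerve D) : D ⥤ TopCat.{max u v} := cover s ⋙ SSet.toTop

/-- The realization of `coverProj`. -/
def coverSpaceProj (s : S ⟶ nerve D) :
    coverSpace s ⟶ (Functor.const D).obj (SSet.toTop.obj S) where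
  app d := SSet.toTop.map ((coverProj s).app d)
  naturality d d' f := by
    have h := congr_arg SSet.toTop.map ((coverProj s).naturality f)
    rw [SSet.toTop.map_comp, SSet.toTop.map_comp] at h
    exact h.trans (congr_arg _ (SSet.toTop.map_id S))

/-- The unit of the adjunction on each fibre of the cover. -/
def coverUnit (s : S ⟶ nerve D) : cover s ⟶ coverSpace s ⋙ TopCat.toSSet where
  app d := sSetTopAdj.unit.app ((cover s).obj d)
  naturality _ _ f := sSetTopAdj.unit.naturality ((cover s).map f)

theorem coverUnit_singularCocone (s : S ⟶ nerve D) :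
    coverUnit s ≫ singularCocone (coverSpaceProj s) =
      coverProj s ≫ (Functor.const D).map (sSetTopAdj.unit.app S) := by
  refine NatTrans.ext (funext fun d ↦ ?_)
  exact (sSetTopAdj.unit.naturality ((coverProj s).app d)).symm

/-- The canonical map from `S` to the total simplicial set of the realized cover. -/
def coverLift (s : S ⟶ nerve D) : S ⟶ twisted (coverSpace s ⋙ TopCat.toSSet) :=
  coverSection s ≫ twisted.map (coverUnit s)

theorem coverLift_proj (s : S ⟶ nerve D) : coverLift s ≫ twisted.proj _ = s := rfl

/-- The unit is adjoint to the identity of the realization, so `coverLift s` is the lift that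
represents the identity when lifts are compared. -/
theorem coverLift_desc (s : S ⟶ nerve D) :
    coverLift s ≫ twisted.desc (singularCocone (coverSpaceProj s)) = sSetTopAdj.unit.app S := by
  rw [coverLift, Category.assoc, twisted.map_comp_desc, coverUnit_singularCocone,
    ← twisted.desc_comp]
  rfl

end Cover

/-! ### Quillen's Theorem A over a groupoid -/

section HomotopyEquivalence

variable {D : Type u} [Groupoid.{max u v} D]

theorem homEquiv_map_comp_symm {S S' : SSet.{u}} {Z : TopCat.{u}} (s : S ⟶ S')
    (t : S' ⟶ TopCat.toSSet.obj Z) :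
    sSetTopAdj.homEquiv S Z (SSet.toTop.map s ≫ (sSetTopAdj.homEquiv S' Z).symm t) = s ≫ t := by
  rw [sSetTopAdj.homEquiv_naturality_left, Equiv.apply_symm_apply]

theorem homEquiv_symm_comp {S : SSet.{u}} {Z Z' : TopCat.{u}} (t : S ⟶ TopCat.toSSet.obj Z)
    (f : Z ⟶ Z') :
    sSetTopAdj.homEquiv S Z' ((sSetTopAdj.homEquiv S Z).symm t ≫ f) =
      t ≫ TopCat.toSSet.map f := by
  rw [sSetTopAdj.homEquiv_naturality_right, Equiv.apply_symm_apply]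

/-- The map of local systems of singular simplicial sets induced by `coverDesc`. -/
def singularCoverDesc {S S' : SSet.{max u v}} {s : S ⟶ nerve D} (t : S ⟶ S') (s' : S' ⟶ nerve D)
    (h : t ≫ s' = s) : coverSpace s ⋙ TopCat.toSSet ⟶ coverSpace s' ⋙ TopCat.toSSet :=
  Functor.whiskerRight (Functor.whiskerRight (coverDesc t s' h) SSet.toTop) TopCat.toSSet

theorem singularCoverDesc_singularCocone {S S' : SSet.{max u v}} {s : S ⟶ nerve D} (t : S ⟶ S')
    (s' : S' ⟶ nerve D) (h : t ≫ s' = s) :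
    singularCoverDesc t s' h ≫ singularCocone (coverSpaceProj s') =
      singularCocone (coverSpaceProj s) ≫
        (Functor.const D).map (TopCat.toSSet.map (SSet.toTop.map t)) := by
  refine NatTrans.ext (funext fun d ↦ ?_)
  have h1 : (coverDesc t s' h).app d ≫ (coverProj s').app d = (coverProj s).app d ≫ t := rfl
  have h2 := congr_arg (fun f ↦ TopCat.toSSet.map (SSet.toTop.map f)) h1
  simp only [SSet.toTop.map_comp, TopCat.toSSet.map_comp] at h2
  exact h2

/-- Quillen's Theorem A over the nerve of a groupoid. -/
theorem exists_homotopyEquiv_of_contractible_cover {S : SSet.{max u v}} (s : S ⟶ nerve D)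
    (hs : ∀ d, ContractibleSpace ((coverSpace s).obj d))
    (hD : ∀ d, ContractibleSpace ((coverSpace (𝟙 (nerve D))).obj d)) :
    ∃ e : ContinuousMap.HomotopyEquiv (SSet.toTop.obj S) (SSet.toTop.obj (nerve D)),
      e.toFun = (SSet.toTop.map s).hom := by
  obtain ⟨l, hl⟩ := exists_twisted_lift hs (𝟙 (nerve D))
  -- The section `l`, pushed from the fibres into the realization of `S`, is adjoint to the homotopy
  -- inverse.
  let g := (sSetTopAdj.homEquiv _ _).symm (l ≫ twisted.desc (singularCocone (coverSpaceProj s)))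
  refine ⟨⟨(SSet.toTop.map s).hom, g.hom, ?_, ?_⟩, rfl⟩
  -- Here `coverLift s` and `s ≫ l` both lift `s`.
  · refine (homotopic_of_twisted_lifts hs (coverLift s) (s ≫ l) ?_ (coverSpaceProj s)
      (𝟙 (SSet.toTop.obj S)) (SSet.toTop.map s ≫ g) ?_ ?_).symm
    · rw [Category.assoc, hl, Category.comp_id, coverLift_proj]
    · rw [sSetTopAdj.homEquiv_id, coverLift_desc]
    · rw [homEquiv_map_comp_symm, Category.assoc]
  -- Here the image of `l` in the cover of `nerve D` and the canonical lift both lie over the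
  -- identity.
  · refine (homotopic_of_twisted_lifts hD (coverLift (𝟙 _))
      (l ≫ twisted.map (singularCoverDesc s (𝟙 _) (Category.comp_id s))) ?_ (coverSpaceProj (𝟙 _))
      (𝟙 (SSet.toTop.obj (nerve D))) (g ≫ SSet.toTop.map s) ?_ ?_).symm
    · rw [coverLift_proj]
      exact hl.symm
    · rw [sSetTopAdj.homEquiv_id, coverLift_desc]
    · rw [homEquiv_symm_comp, Category.assoc, Category.assoc, twisted.map_comp_desc,
        singularCoverDesc_singularCocone, twisted.desc_comp]

end HomotopyEquivalence

/-! ### Fibres of the cover as nerves of structured arrows -/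

section StructuredArrow

open Opposite Simplicial

variable {C D : Type u} [Category.{v} C] [Groupoid.{max u v} D] (F : C ⥤ D) (d : D)

/-- Structure maps are invertible in `D`, so they cancel, and faithfulness does the rest. -/
theorem isThin_structuredArrow [F.Faithful] : Quiver.IsThin (StructuredArrow d F) :=
  fun _ _ ↦ ⟨fun f g ↦ StructuredArrow.hom_ext _ _ (F.map_injective
    ((cancel_epi (_ : d ⟶ _)).1 ((StructuredArrow.w f).trans (StructuredArrow.w g).symm)))⟩

/-- The comparison of the nerve of a category of structured arrows with the fibre of the cover. -/
def nerveStructuredArrowToCover :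
    (nerve (StructuredArrow d F) : SSet.{max u v}) ⟶ coverFibre (nerveMapOfFunctor F) d where
  app n := ↾fun σ ↦ ⟨(((StructuredArrow.proj d F).mapComposableArrows n.unop.len).obj σ,
    ⟨((StructuredArrow.proj d F ⋙ F).mapComposableArrows n.unop.len).obj σ,
      (ComposableArrows.left (n := n.unop.len) σ).hom⟩), rfl⟩
  naturality n m θ := by
    refine ConcreteCategory.hom_ext _ _ fun σ ↦ coverFibre_ext ?_ ?_
    · rfl
    · refine congr_arg (Sigma.mk _) ?_
      exact (StructuredArrow.w
        (ComposableArrows.map' (n := n.unop.len) σ 0 (θ.unop.toOrderHom 0))).symm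

/-- The chain of structured arrows given by a chain of arrows and a structure map to its initial
vertex. -/
def structuredArrowChain {n : ℕ} (x : ComposableArrows C n) (a : d ⟶ F.obj x.left) :
    ComposableArrows (StructuredArrow d F) n where
  obj i := StructuredArrow.mk (a ≫ F.map (x.map (homOfLE (Fin.zero_le i))))
  map {i j} f := StructuredArrow.homMk (x.map f) (by
    simp only [StructuredArrow.mk_hom_eq_self, Category.assoc, ← F.map_comp, ← x.map_comp]
    rfl)

/-- Compatibility forces every structure map from the first one. This gives the injectivity of the
comparison with the fibre of the cover. -/
theorem eq_structuredArrowChain [F.Faithful] {n : ℕ}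
    (σ : ComposableArrows (StructuredArrow d F) n) :
    σ = structuredArrowChain F d (((StructuredArrow.proj d F).mapComposableArrows n).obj σ)
      σ.left.hom := by
  have := isThin_structuredArrow F d
  refine ComposableArrows.ext (fun i ↦ ?_) (fun _ _ ↦ Subsingleton.elim _ _)
  refine (StructuredArrow.eq_mk _).trans (congr_arg StructuredArrow.mk ?_)
  exact (StructuredArrow.w (σ.map (homOfLE (Fin.zero_le i)))).symm

theorem structuredArrowChain_congr {n : ℕ} {x x' : ComposableArrows C n}
    {a : d ⟶ F.obj x.left} {a' : d ⟶ F.obj x'.left} (h : x = x')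
    (ha : (⟨(F.mapComposableArrows n).obj x, a⟩ : Σ τ : ComposableArrows D n, (d ⟶ τ.left)) =
      ⟨(F.mapComposableArrows n).obj x', a'⟩) :
    structuredArrowChain F d x a = structuredArrowChain F d x' a' := by
  subst h
  rw [eq_of_heq (Sigma.mk.inj ha).2]

theorem isIso_nerveStructuredArrowToCover [F.Faithful] :
    IsIso (nerveStructuredArrowToCover F d) := by
  have : ∀ n, IsIso ((nerveStructuredArrowToCover F d).app n) := fun n ↦ by
    rw [isIso_iff_bijective]
    refine ⟨fun σ σ' h ↦ ?_, fun p ↦ ?_⟩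
    · refine (eq_structuredArrowChain (n := n.unop.len) F d σ).trans
        (Eq.trans ?_ (eq_structuredArrowChain (n := n.unop.len) F d σ').symm)
      have h1 := Subtype.ext_iff.1 h
      exact structuredArrowChain_congr F d (congr_arg Prod.fst h1) (congr_arg Prod.snd h1)
    · obtain ⟨⟨x, τ, a⟩, h⟩ := p
      change (nerveMapOfFunctor F).app n x = τ at h
      subst h
      refine ⟨structuredArrowChain (n := n.unop.len) F d x a, coverFibre_ext ?_ ?_⟩
      · rfl
      · refine congr_arg (Sigma.mk _) ?_
        refine (congr_arg (a ≫ ·) ((congr_arg F.map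
          (CategoryTheory.Functor.map_id (C := Fin (n.unop.len + 1)) x 0)).trans
          (F.map_id _))).trans ?_
        exact Category.comp_id (X := d) _
  exact NatIso.isIso_of_isIso_app _

variable [Nonempty (StructuredArrow d F)] [F.Faithful]
  (h : ∀ x y : StructuredArrow d F, ∃ z, Nonempty (z ⟶ x) ∧ Nonempty (z ⟶ y))
include h

theorem contractibleSpace_nerve_structuredArrow :
    ContractibleSpace (SSet.toTop.obj (nerve (StructuredArrow d F))) :=
  have := isThin_structuredArrow F d
  contractibleSpace_nerve_of_isThin h

theorem contractibleSpace_coverSpace :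
    ContractibleSpace ((coverSpace (nerveMapOfFunctor F)).obj d) := by
  have := isIso_nerveStructuredArrowToCover F d
  have := contractibleSpace_nerve_structuredArrow F d h
  exact (TopCat.homeoOfIso (SSet.toTop.mapIso
    (asIso (nerveStructuredArrowToCover F d)))).symm.contractibleSpace

end StructuredArrow

/-! ### Consequences of the calculus of fractions -/

section Main

variable {C : Type u} [Category.{v} C]

/-- In a right calculus of fractions, arrows with equal images are equalized by precomposition with
some `s`, which left cancellation removes. -/
theorem faithful_toFundamentalGroupoid (hC : SatisfiesCancellativeCalculusOfFractions C) :
    (toFundamentalGroupoid C).Faithful where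
  map_injective {X Y} f g h := by
    have := hC.fractions
    obtain ⟨Z, s, -, hs⟩ :=
      (MorphismProperty.map_eq_iff_precomp (toFundamentalGroupoid C) ⊤ f g).1 h
    exact hC.left_cancel s f g hs

/-- Write `x⁻¹y` as a right fraction `s⁻¹f`. The object `x s⁻¹` then maps to `x` by `s` and to `y`
by `f`. -/
theorem exists_lower_bound_structuredArrow (hC : SatisfiesCancellativeCalculusOfFractions C)
    {d : FundamentalGroupoidOfCategory C} (x y : StructuredArrow d (toFundamentalGroupoid C)) :
    ∃ z, Nonempty (z ⟶ x) ∧ Nonempty (z ⟶ y) := by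
  have := hC.fractions
  obtain ⟨φ, hφ⟩ := Localization.exists_rightFraction (toFundamentalGroupoid C) ⊤
    (Groupoid.inv x.hom ≫ y.hom)
  have h1 : (toFundamentalGroupoid C).map φ.s ≫ Groupoid.inv x.hom ≫ y.hom =
      (toFundamentalGroupoid C).map φ.f := by
    rw [hφ]
    exact φ.map_s_comp_map _ _
  refine ⟨StructuredArrow.mk (x.hom ≫ Groupoid.inv ((toFundamentalGroupoid C).map φ.s)),
    ⟨StructuredArrow.homMk φ.s ?_⟩, ⟨StructuredArrow.homMk φ.f ?_⟩⟩
  · simp [Groupoid.inv_eq_inv]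
  · rw [← h1]
    simp [Groupoid.inv_eq_inv]

theorem contractibleSpace_coverSpace_id {D : Type u} [Groupoid.{max u v} D] (d : D) :
    ContractibleSpace ((coverSpace (𝟙 (nerve D))).obj d) := by
  have : Nonempty (StructuredArrow d (𝟭 D)) := ⟨StructuredArrow.mk (𝟙 d)⟩
  -- The identity of the nerve is definitionally the nerve map of `𝟭 D`, and `𝟙 d` lies below every
  -- structured arrow.
  refine contractibleSpace_coverSpace.{max u v} (𝟭 D) d fun x y ↦
    ⟨StructuredArrow.mk (Y := d) (𝟙 d), ⟨StructuredArrow.homMk x.hom ?_⟩,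
      ⟨StructuredArrow.homMk y.hom ?_⟩⟩
  · exact Category.id_comp _
  · exact Category.id_comp _

end Main

theorem proposition20889 {C : Type u} [Category.{v} C]
    (hC : SatisfiesCancellativeCalculusOfFractions C) :
    (toFundamentalGroupoid C).Faithful ∧
    IsHomotopyEquivalenceFunctor (toFundamentalGroupoid C) ∧
    ∀ X : C, IsGeneralizedPoset (UniversalCoveringCategory C X) ∧
      IsContractibleCategory (UniversalCoveringCategory C X) := by
  have hF := faithful_toFundamentalGroupoid hC
  have hne : ∀ X : C, Nonempty (UniversalCoveringCategory C X) := fun X ↦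
    ⟨StructuredArrow.mk (𝟙 _)⟩
  refine ⟨hF, ?_, fun X ↦ ⟨fun A B α β ↦ ?_, ?_⟩⟩
  · refine exists_homotopyEquiv_of_contractible_cover.{v} (nerveMapOfFunctor _) (fun d ↦ ?_)
      contractibleSpace_coverSpace_id.{v}
    -- Every object of the free groupoid comes from `C`, so the fibres to be contracted are
    -- universal covering categories.
    obtain ⟨X, rfl⟩ := FreeGroupoid.of_obj_bijective.2 d
    have := hne X
    exact contractibleSpace_coverSpace _ _ (exists_lower_bound_structuredArrow hC)
  · exact (isThin_structuredArrow (toFundamentalGroupoid C) _ A B).elim α β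
  · have := hne X
    exact contractibleSpace_nerve_structuredArrow (toFundamentalGroupoid C) _
      (exists_lower_bound_structuredArrow hC)

end
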